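/- **Setting.** Let $n_0=k\ge 1$, let $n_1,\dots,n_d$ be integers with $n_i\ge 5n_{i-1}$ for $1\le i\le d$, and put $n=n_d$. For matrices $W_i\in\mathbb R^{n_i\times n_{i-1}}$ let $G(z)=\phi_d(\cdots\phi_1(z)\cdots)$ with $\phi_i(a)=\mathrm{ReLU}(W_ia)$, where $\mathrm{ReLU}(t)=\max\{t,0\}$ is applied coordinatewise. The entries of all the $W_i$ are independent $\mathcal N(0,1)$ random variables. For a matrix $W$ and a set $I$ of row indices, $W_{I,:}$ is the submatrix of the rows in $I$. **Algorithm.** For a matrix $W\in\mathbb R^{N\times p}$ with rows $w_1^\top,\dots,w_N^\top$, a vector $x\in\mathbb R^N$ and $\epsilon\ge 0$, the $\ell_\infty$ linear program $\mathrm{LP}(W,x,\epsilon)$ minimizes $\delta$ over $(z,\delta)\in\mathbb R^p\times\mathbb R$ subject to $$x_j-\delta\le w_j^\top z\le x_j+\delta\ \text{ if } x_j>\epsilon,\qquad w_j^\top z\le x_j+\delta\ \text{ if } x_j\le\epsilon,\qquad \delta\le\epsilon .$$ Given an observation $x\in\mathbb R^n$ with noise level $\epsilon$ and a constant $c_2>0$,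 the layerwise $\ell_\infty$ LP puts $z_d=x$ and, for $i=d,d-1,\dots,1$, takes for $z_{i-1}$ the $z$-part of any optimal solution of $\mathrm{LP}\big(W_i,z_i,(2/c_2)^{d-i}\epsilon\big)$; its output is $z=z_0$. **Statement.** There are absolute constants $c_2\in(0,2]$ and $C,\gamma>0$ such that for all $d$ and all $n_0,\dots,n_d$ as above the following hold. 1. For every $i\in\{1,\dots,d\}$ the matrix $W_i$ extends the $\ell_\infty$ norm on submatrices with constant $c_2$. That is, there is an integer $m$ with $n_{i-1}<m\le \frac25 n_i$ such that, with probability at least $1-Ce^{-\gamma n_{i-1}}$, $$\|(W_i)_{I,:}\,x\|_\infty\ge c_2\|x\|_\infty\quad\text{for all } I\subset\{1,\dots,n_i\} \text{ with } |I|\ge m \text{ and all } x\in\mathbb R^{n_{i-1}};$$ and for each fixed $I\subset\{1,\dots,n_i\}$ with $|I|\ge 2n_{i-1}$, with probability at least $1-Ce^{-\gamma n_{i-1}}$, this inequality holds for all $x\in\mathbb R^{n_{i-1}}$. 2. For every fixed $z^*\in\mathbb R^k$, with probability at least $1-Ce^{-\gamma k}$ the following holds for all $e\in\mathbb R^n$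 (which may depend on the weights) whose norm $\epsilon=\|e\|_\infty$ satisfies $\epsilon<\frac{c_2^d}{2^{d+4}}\|z^*\|_2\sqrt k$: run on the observation $x=G(z^*)+e$, the layerwise $\ell_\infty$ LP meets only linear programs that have an optimal solution, and, whichever optimal solutions it takes, its output $z$ satisfies $\|z-z^*\|_\infty\le \frac{2^d\epsilon}{c_2^d}$. -/

import Mathlib

open MeasureTheory ProbabilityTheory

/-- The layer map `a ↦ ReLU (A a)`, with `ReLU` applied coordinatewise and no bias. -/
def reluLayer {N k : ℕ} (A : Matrix (Fin N) (Fin k) ℝ) (a : Fin k → ℝ) : Fin N → ℝ :=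
  fun j => max ((A.mulVec a) j) 0

/-- The output of the `i`-th layer on the input `z`; `W i` is the weight matrix of the layer that
maps `ℝ^(n i)` to `ℝ^(n (i+1))`. The `d`-layer generator is `netOutput n W z d`. -/
def netOutput (n : ℕ → ℕ) (W : (i : ℕ) → Matrix (Fin (n (i + 1))) (Fin (n i)) ℝ)
    (z : Fin (n 0) → ℝ) : (i : ℕ) → Fin (n i) → ℝ
  | 0 => z
  | i + 1 => reluLayer (W i) (netOutput n W z i)

/-- The entries of the random weight matrices of the first `d` layers are jointly independent
standard Gaussian variables. -/
def IsIIDStdGaussian {Ω : Type*} [MeasurableSpace Ω] (μ : Measure Ω) (d : ℕ) (n : ℕ → ℕ)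
    (W : (i : ℕ) → Ω → Matrix (Fin (n (i + 1))) (Fin (n i)) ℝ) : Prop :=
  (∀ i < d, ∀ (a : Fin (n (i + 1))) (b : Fin (n i)),
      HasLaw (fun ω => W i ω a b) (gaussianReal 0 1) μ) ∧
    iIndepFun
      (fun (p : Σ i : Fin d, Fin (n (i + 1)) × Fin (n i)) (ω : Ω) => W p.1 ω p.2.1 p.2.2) μ

/-- `‖A_I x‖_∞ ≥ c ‖x‖_∞` for all `x`, where `A_I` consists of the rows of `A` with index in `I`.
(The norm of `Fin k → ℝ` and of `I → ℝ` is the sup norm.) -/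
def RowsExtend {N k : ℕ} (A : Matrix (Fin N) (Fin k) ℝ) (I : Finset (Fin N)) (c : ℝ) : Prop :=
  ∀ x : Fin k → ℝ, c * ‖x‖ ≤ ‖(A.submatrix (fun j : I => (j : Fin N)) id).mulVec x‖

/-- Except with probability at most `p`, all submatrices with at least `m` rows extend the sup norm
simultaneously. -/
def AllSubmatricesExtend {Ω : Type*} [MeasurableSpace Ω] (μ : Measure Ω) {N k : ℕ}
    (A : Ω → Matrix (Fin N) (Fin k) ℝ) (m : ℕ) (c p : ℝ) : Prop :=
  μ {ω | ¬ ∀ I : Finset (Fin N), m ≤ I.card → RowsExtend (A ω) I c} ≤ ENNReal.ofReal p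

/-- Each given submatrix with at least `m` rows extends the sup norm, except with probability at
most `p`. -/
def EachSubmatrixExtends {Ω : Type*} [MeasurableSpace Ω] (μ : Measure Ω) {N k : ℕ}
    (A : Ω → Matrix (Fin N) (Fin k) ℝ) (m : ℕ) (c p : ℝ) : Prop :=
  ∀ I : Finset (Fin N), m ≤ I.card → μ {ω | ¬ RowsExtend (A ω) I c} ≤ ENNReal.ofReal p

/-- The constraints of the `ℓ_∞` linear program that inverts one layer, with matrix `A`,
observation `x` and error bound `ε`, in the variables `z` and `δ`. -/
def LPFeasible {N k : ℕ} (A : Matrix (Fin N) (Fin k) ℝ) (x : Fin N → ℝ) (ε : ℝ)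
    (z : Fin k → ℝ) (δ : ℝ) : Prop :=
  (∀ j, ε < x j → x j - δ ≤ (A.mulVec z) j ∧ (A.mulVec z) j ≤ x j + δ) ∧
    (∀ j, x j ≤ ε → (A.mulVec z) j ≤ x j + δ) ∧ δ ≤ ε

/-- `z` is an output of the linear program: together with some `δ` it is feasible and minimizes
`δ` among all feasible pairs. -/
def IsLPSolution {N k : ℕ} (A : Matrix (Fin N) (Fin k) ℝ) (x : Fin N → ℝ) (ε : ℝ)
    (z : Fin k → ℝ) : Prop :=
  ∃ δ, LPFeasible A x ε z δ ∧ ∀ z' δ', LPFeasible A x ε z' δ' → δ ≤ δ'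

/-- `InversionReaches n W x d tol i y`: the layerwise inversion, started from the observation `x` of
the output of layer `d` and using the error bound `tol i` to invert layer `i`, can arrive at the
vector `y` as its reconstruction of the output of layer `i`. (Whenever the linear program of a layer
has several solutions, any of them may be chosen.) -/
inductive InversionReaches (n : ℕ → ℕ) (W : (i : ℕ) → Matrix (Fin (n (i + 1))) (Fin (n i)) ℝ)
    (d : ℕ) (x : Fin (n d) → ℝ) (tol : ℕ → ℝ) : (i : ℕ) → (Fin (n i) → ℝ) → Prop
  | start : InversionReaches n W d x tol d x
  | step {i : ℕ} {y : Fin (n (i + 1)) → ℝ} {z : Fin (n i) → ℝ} :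
      InversionReaches n W d x tol (i + 1) y → IsLPSolution (W i) y (tol (i + 1)) z →
      InversionReaches n W d x tol i z

/-- The layerwise inversion never gets stuck (every linear program that it meets has a solution),
and, whichever solutions are chosen, its final output is within `r` of `zstar` in the sup norm. -/
def InversionRecovers (n : ℕ → ℕ) (W : (i : ℕ) → Matrix (Fin (n (i + 1))) (Fin (n i)) ℝ)
    (d : ℕ) (x : Fin (n d) → ℝ) (tol : ℕ → ℝ) (zstar : Fin (n 0) → ℝ) (r : ℝ) : Prop :=
  (∀ i < d, ∀ y, InversionReaches n W d x tol (i + 1) y →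
      ∃ z, IsLPSolution (W i) y (tol (i + 1)) z) ∧
    ∀ z, InversionReaches n W d x tol 0 z → ‖z - zstar‖ ≤ r

/-! The probabilistic core is a union bound over minimal faces of a random polyhedron, in place of a
net argument. Suppose the slice `x i = ρ` of a polyhedron cut out by N independent random rows in
dimension k is nonempty. A minimal face of the slice is then an affine flat, given by the slice
equation and fewer than k tight constraints. The minimum norm point of this flat depends only on the
selected rows, and all other rows must satisfy their constraints there. Conditioning on the selected
rows bounds the probability by a sum of `p ^ (N - |K|)` over the selections K
(`measure_pi_exists_feasible_le`).

For the slab constraints |⟨w, x⟩| ≤ c, the Gaussian small-ball bound p ≤ c gives the extension of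
the sup norm. As c is tiny, the estimate survives a union over all row sets, which is needed because
the active rows depend on the weights. A Chernoff bound shows that about two fifths of the rows
satisfy ⟨w, y⟩ > ‖y‖₂/500 for a fixed nonzero y. It applies to layer outputs because they are
independent of the next weight matrix. If these coordinates exceed twice the tolerance, they carry
two-sided constraints, so every feasible point is within 2ε of the truth on those rows, hence within
2ε/c in the sup norm (`lp_recovers_of_rowsExtend`).

The admissible error carries a factor √k. Layer outputs from the first onward gain the same factor,
but the input z* does not, so at the last inversion the tolerance may exceed the signal scale. There
the linear program is shown to have a feasible region of radius O(ε), by the same face argument with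
one-sided constraints (`measure_pi_exists_large_le`, `lp_recovers_of_bounded`).

None of the bad events mentions e, so the conclusion is uniform over all perturbations. -/

open scoped ENNReal NNReal

/-! ### Minimal faces of systems of linear inequalities -/

/-- A feasible point of a system of linear inequalities whose set of tight constraints is as large
as possible has the property that every constraint is a combination of tight ones. -/
theorem exists_feasible_span_tight {V T : Type*} [AddCommGroup V] [Module ℝ V] [Finite T]
    (g : Module.Dual ℝ V) (f : T → Module.Dual ℝ V) (b : T → ℝ) (x₀ : V)
    (h₀ : ∀ t, f t x₀ ≤ b t) :
    ∃ x, g x = g x₀ ∧ (∀ t, f t x ≤ b t) ∧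
      ∀ t, f t ∈ Submodule.span ℝ (insert g (f '' {s | f s x = b s})) := by
  classical
  cases nonempty_fintype T
  let F : Set V := {x | g x = g x₀ ∧ ∀ t, f t x ≤ b t}
  let tight : V → Finset T := fun x => Finset.univ.filter fun s => f s x = b s
  have hbd : ∃ n, ∃ x ∈ F, (tight x).card = n ∧ ∀ y ∈ F, (tight y).card ≤ n := by
    have hfin : (((fun x => (tight x).card) '' F)).Finite :=
      (Set.finite_Iic (Fintype.card T)).subset (by
        rintro _ ⟨x, _, rfl⟩
        exact Finset.card_le_univ _)
    obtain ⟨_, hx, hmax⟩ := hfin.exists_maximal (Set.Nonempty.image _ ⟨x₀, rfl, h₀⟩)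
    obtain ⟨y, hy, rfl⟩ := hx
    refine ⟨_, y, hy, rfl, fun z hz => ?_⟩
    rcases le_total (tight z).card (tight y).card with h | h
    · exact h
    · exact hmax ⟨z, hz, rfl⟩ h
  obtain ⟨n, x, hxF, hxn, hmax⟩ := hbd
  refine ⟨x, hxF.1, hxF.2, fun t => ?_⟩
  by_contra hspan
  -- By duality, a functional outside the span is nonzero on some direction that annihilates `g` and
  -- all tight constraints.
  have hker : ∃ y, g y = 0 ∧ (∀ s, f s x = b s → f s y = 0) ∧ f t y ≠ 0 := by
    by_contra hcon
    push Not at hcon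
    apply hspan
    let L : Option {s // f s x = b s} → V →ₗ[ℝ] ℝ := fun o => o.elim g fun s => f s
    have hL : f t ∈ Submodule.span ℝ (Set.range L) := by
      refine mem_span_of_iInf_ker_le_ker fun y hy => ?_
      simp only [Submodule.mem_iInf, LinearMap.mem_ker] at hy ⊢
      exact hcon y (hy none) fun s hs => hy (some ⟨s, hs⟩)
    refine Submodule.span_mono ?_ hL
    rintro _ ⟨o, rfl⟩
    cases o with
    | none => exact Set.mem_insert _ _
    | some s => exact Set.mem_insert_of_mem _ ⟨s, s.2, rfl⟩
  obtain ⟨y, hgy, hty, hfy⟩ : ∃ y, g y = 0 ∧ (∀ s, f s x = b s → f s y = 0) ∧ 0 < f t y := by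
    obtain ⟨y, h1, h2, h3⟩ := hker
    rcases lt_or_gt_of_ne h3 with h | h
    · exact ⟨-y, by simp [h1], fun s hs => by simp [h2 s hs], by simpa using h⟩
    · exact ⟨y, h1, h2, h⟩
  -- Ratio test: move along `y` until the first slack constraint becomes tight. The old tight ones
  -- stay tight, contradicting maximality.
  let P : Finset T := Finset.univ.filter fun s => 0 < f s y
  obtain ⟨s₀, hs₀, hmin⟩ := P.exists_min_image (fun s => (b s - f s x) / f s y)
    ⟨t, by simpa [P] using hfy⟩
  have hs₀pos : 0 < f s₀ y := by simpa [P] using hs₀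
  set r := (b s₀ - f s₀ x) / f s₀ y with hr
  have hr0 : 0 ≤ r := div_nonneg (sub_nonneg.2 (hxF.2 s₀)) hs₀pos.le
  have hnew : x + r • y ∈ F := by
    refine ⟨by simp [hgy, hxF.1], fun s => ?_⟩
    simp only [map_add, map_smul, smul_eq_mul]
    rcases le_or_gt (f s y) 0 with h | h
    · nlinarith [hxF.2 s]
    · have := hmin s (by simpa [P] using h)
      rw [le_div_iff₀ h] at this
      linarith
  have hsub : insert s₀ (tight x) ⊆ tight (x + r • y) := by
    intro s hs
    rw [Finset.mem_insert] at hs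
    simp only [tight, Finset.mem_filter, Finset.mem_univ, true_and, map_add, map_smul,
      smul_eq_mul]
    rcases hs with rfl | hs
    · rw [hr]; field_simp; ring
    · have hs' : f s x = b s := by simpa [tight] using hs
      rw [hty s hs', hs']; ring
  have hnot : s₀ ∉ tight x := by
    intro h
    have : f s₀ x = b s₀ := by simpa [tight] using h
    exact hs₀pos.ne' (hty s₀ this)
  have := Finset.card_le_card hsub
  rw [Finset.card_insert_of_notMem hnot] at this
  have := hmax _ hnew
  omega

/-- A solvable system of linear inequalities together with one equation `g x = ρ` has a linearly
independent subsystem all of whose equality solutions solve the system. -/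
theorem exists_linearIndependent_tight {V T : Type*} [AddCommGroup V] [Module ℝ V] [Finite T]
    (g : Module.Dual ℝ V) (hg : g ≠ 0) (f : T → Module.Dual ℝ V) (b : T → ℝ) (x₀ : V)
    (h₀ : ∀ t, f t x₀ ≤ b t) :
    ∃ K : Finset T, LinearIndependent ℝ (fun o : Option K => o.elim g fun t => f t) ∧
      ∀ v, g v = g x₀ → (∀ t ∈ K, f t v = b t) → ∀ t, f t v ≤ b t := by
  classical
  cases nonempty_fintype T
  obtain ⟨x, hgx, hx, hspan⟩ := exists_feasible_span_tight g f b x₀ h₀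
  let F : Option T → Module.Dual ℝ V := fun o => o.elim g f
  -- Starting the extension from `none` keeps `g` itself in the independent family.
  obtain ⟨u, hut, hsu, hvu, hu⟩ := exists_linearIndepOn_extension (K := ℝ) (v := F)
    (s := {none}) (t := insert none (some '' {s | f s x = b s}))
    (LinearIndepOn.singleton (by simpa [F] using hg)) (by simp)
  have hnone : none ∈ u := hsu rfl
  let K : Finset T := Finset.univ.filter fun t => some t ∈ u
  have hK : ∀ t, t ∈ K ↔ some t ∈ u := fun t => by simp [K]
  refine ⟨K, ?_, fun v hgv hKv t => ?_⟩
  · let φ : Option K → u := fun o => match o with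
      | none => ⟨none, hnone⟩
      | some t => ⟨some t, (hK t).1 t.2⟩
    have hφ : Function.Injective φ := by
      intro a b hab
      cases a <;> cases b <;> simp only [φ, Subtype.mk.injEq, Option.some.injEq, reduceCtorEq,
        Subtype.val_inj] at hab ⊢
      exact hab
    have h : (fun o : Option K => o.elim g fun t => f t) = (fun o : u => F o) ∘ φ := by
      ext o : 1
      cases o <;> rfl
    rw [h]
    exact LinearIndependent.comp hu φ hφ
  · have hker : ∀ h ∈ Submodule.span ℝ (F '' u), h v = h x := by
      intro h hh
      have hle : Submodule.span ℝ (F '' u) ≤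
          LinearMap.ker ((Module.Dual.eval ℝ V v) - (Module.Dual.eval ℝ V x)) := by
        rw [Submodule.span_le]
        rintro _ ⟨o, ho, rfl⟩
        simp only [SetLike.mem_coe, LinearMap.mem_ker, LinearMap.sub_apply,
          Module.Dual.eval_apply, sub_eq_zero]
        cases o with
        | none => exact hgv.trans hgx.symm
        | some s =>
          have h1 : f s x = b s := by
            have := hut ho
            simpa using this
          exact (hKv s ((hK s).2 ho)).trans h1.symm
      simpa [sub_eq_zero] using hle hh
    have hmem : f t ∈ Submodule.span ℝ (F '' u) := by
      refine Submodule.span_le.2 ?_ (hspan t)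
      intro h hh
      apply hvu
      rcases hh with rfl | ⟨s, hs, rfl⟩
      · exact ⟨none, by simp, rfl⟩
      · exact ⟨some s, Set.mem_insert_of_mem _ ⟨s, hs, rfl⟩, rfl⟩
    rw [hker _ hmem]
    exact hx t

/-! ### Minimum norm solutions, as measurable functions of the data -/

/-- The minimum norm solution `Aᵀ (A Aᵀ)⁻¹ b` of the linear system `A v = b`, for a matrix `A` with
linearly independent rows. -/
noncomputable def minNormSolution {m ι : Type*} [Fintype m] [DecidableEq m]
    (A : m → ι → ℝ) [Fintype ι] (b : m → ℝ) : ι → ℝ :=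
  fun l => ∑ o, A o l * ∑ o', (Matrix.of A * (Matrix.of A).transpose).det⁻¹ *
    (Matrix.of A * (Matrix.of A).transpose).adjugate o o' * b o'

/-- The Gram matrix is invertible: if A Aᵀ x = 0 then |Aᵀ x|² = 0, and independence of the rows
forces x = 0. -/
theorem dotProduct_minNormSolution {m ι : Type*} [Fintype m] [DecidableEq m] [Fintype ι]
    {A : m → ι → ℝ} (hA : LinearIndependent ℝ A) (b : m → ℝ) (o : m) :
    A o ⬝ᵥ minNormSolution A b = b o := by
  set M : Matrix m ι ℝ := Matrix.of A with hM
  set G := M * M.transpose with hG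
  have hunit : IsUnit G.det := by
    rw [← Matrix.isUnit_iff_isUnit_det, ← Matrix.mulVec_injective_iff_isUnit]
    refine (injective_iff_map_eq_zero (Matrix.mulVecLin G)).2 fun x hx => ?_
    have hx' : G.mulVec x = 0 := hx
    have h1 : M.transpose.mulVec x ⬝ᵥ M.transpose.mulVec x = 0 := by
      rw [Matrix.dotProduct_mulVec, Matrix.vecMul_transpose, Matrix.mulVec_mulVec, ← hG, hx']
      simp
    rw [dotProduct_self_eq_zero, Matrix.mulVec_transpose] at h1
    have h2 := (Matrix.vecMul_injective_iff (M := M)).2 hA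
    exact h2 (h1.trans (Matrix.zero_vecMul _).symm)
  have hsol : minNormSolution A b = M.transpose.mulVec (G⁻¹.mulVec b) := by
    ext l
    simp only [minNormSolution, Matrix.mulVec, dotProduct, Matrix.transpose_apply]
    refine Finset.sum_congr rfl fun o _ => ?_
    simp only [Matrix.inv_def, Ring.inverse_eq_inv', Matrix.smul_apply, smul_eq_mul]
    rfl
  have : M.mulVec (minNormSolution A b) = b := by
    rw [hsol, Matrix.mulVec_mulVec, ← hG, Matrix.mulVec_mulVec, Matrix.mul_nonsing_inv _ hunit,
      Matrix.one_mulVec]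
  exact congrFun this o

/-- Needed to condition on the selected rows. The determinant and adjugate formula is total, so
measurability holds without assuming independent rows. -/
theorem measurable_minNormSolution {α m ι : Type*} [MeasurableSpace α] [Fintype m] [DecidableEq m]
    [Fintype ι] {A : α → m → ι → ℝ} {b : α → m → ℝ} (hA : ∀ o l, Measurable fun a => A a o l)
    (hb : ∀ o, Measurable fun a => b a o) :
    Measurable fun a => minNormSolution (A a) (b a) := by
  have hG : ∀ o o', Measurable fun a =>
      (Matrix.of (A a) * (Matrix.of (A a)).transpose) o o' := by
    intro o o'
    simp only [Matrix.mul_apply, Matrix.of_apply, Matrix.transpose_apply]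
    fun_prop
  have hdet : ∀ N : α → Matrix m m ℝ, (∀ o o', Measurable fun a => N a o o') →
      Measurable fun a => (N a).det := by
    intro N hN
    simp only [Matrix.det_apply]
    fun_prop
  rw [measurable_pi_iff]
  intro l
  unfold minNormSolution
  refine Finset.measurable_fun_sum _ fun o _ => (hA o l).mul
    (Finset.measurable_fun_sum _ fun o' _ => Measurable.mul (Measurable.mul ?_ ?_) (hb o'))
  · exact (hdet _ hG).inv
  · simp only [Matrix.adjugate_apply]
    refine hdet _ fun i j => ?_
    simp only [Matrix.updateRow_apply]
    split_ifs
    · exact measurable_const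
    · exact hG _ _

/-! ### Union bound over the faces of a random polyhedron -/

/-- If `v` depends only on the rows in `K`, the event that every other row is in a given relation
to `v` has the probability of independent trials. -/
theorem measure_pi_forall_notMem_le {J E V : Type*} [Fintype J] [DecidableEq J]
    [MeasurableSpace E] [MeasurableSpace V] (ν : Measure E) [IsProbabilityMeasure ν]
    (K : Finset J) {v : (K → E) → V} (hv : Measurable v) {S : Set (V × E)}
    (hS : MeasurableSet S) {p : ℝ≥0∞} (hp : ∀ y, ν {w | (v y, w) ∈ S} ≤ p) :
    Measure.pi (fun _ : J => ν) {W | ∀ j ∉ K, (v (fun j : K => W j), W j) ∈ S} ≤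
      p ^ (Fintype.card J - K.card) := by
  let B : Set ((K → E) × ({j // j ∉ K} → E)) := {q | ∀ j, (v q.1, q.2 j) ∈ S}
  have hB : MeasurableSet B := by
    have : B = ⋂ j, {q | (v q.1, q.2 j) ∈ S} := by ext; simp [B]
    rw [this]
    refine MeasurableSet.iInter fun j => ?_
    exact ((hv.comp measurable_fst).prodMk ((measurable_pi_apply j).comp measurable_snd)) hS
  have hmp := measurePreserving_piEquivPiSubtypeProd (fun _ : J => ν) (fun j => j ∈ K)
  have hpre : {W : J → E | ∀ j ∉ K, (v (fun j : K => W j), W j) ∈ S} =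
      (MeasurableEquiv.piEquivPiSubtypeProd (fun _ : J => E) (fun j => j ∈ K)) ⁻¹' B := by
    ext W
    simp only [B, Set.mem_ofPred_eq, Set.mem_preimage, Subtype.forall]
    rfl
  rw [hpre, hmp.measure_preimage hB.nullMeasurableSet, Measure.prod_apply hB]
  have hsec : ∀ y : K → E, (Measure.pi fun _ : {j // j ∉ K} => ν) (Prod.mk y ⁻¹' B) ≤
      p ^ (Fintype.card J - K.card) := by
    intro y
    have : Prod.mk y ⁻¹' B = Set.pi Set.univ fun _ => {w | (v y, w) ∈ S} := by
      ext; simp [B]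
    rw [this, Measure.pi_pi, Finset.prod_const]
    refine (pow_le_pow_left' (hp y) _).trans_eq ?_
    congr 1
    rw [Finset.card_univ, Fintype.card_subtype_compl, Fintype.card_coe]
  refine (lintegral_mono hsec).trans_eq ?_
  simp

/-- Union bound over the vertices of a random polyhedron. The rows `W j` are independent with
law `ν`; if each point `v` of the hyperplane `v i = ρ` satisfies the constraints of one random row
with probability at most `p`, then the slice of the polyhedron by this hyperplane is empty, up to
the given probability. -/
theorem measure_pi_exists_feasible_le {J S : Type*} [Fintype J] [DecidableEq J] [Fintype S]
    [DecidableEq S] {k : ℕ} (ν : Measure (Fin k → ℝ)) [IsProbabilityMeasure ν]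
    (s : S → ℝ) {b : S → (Fin k → ℝ) → ℝ} (hb : ∀ σ, Measurable (b σ)) (i : Fin k) (ρ : ℝ)
    {p : ℝ≥0∞} (hp1 : p ≤ 1)
    (hp : ∀ v : Fin k → ℝ, v i = ρ → ν {w | ∀ σ, s σ * (w ⬝ᵥ v) ≤ b σ w} ≤ p) :
    Measure.pi (fun _ : J => ν)
        {W | ∃ x : Fin k → ℝ, x i = ρ ∧ ∀ j σ, s σ * (W j ⬝ᵥ x) ≤ b σ (W j)} ≤
      ∑ K : Finset (J × S) with K.card < k, p ^ (Fintype.card J - K.card) := by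
  classical
  let A : (K : Finset (J × S)) → (K.image Prod.fst → Fin k → ℝ) → Option K → Fin k → ℝ :=
    fun K y o => o.elim (Pi.single i 1) fun t => s t.1.2 • y ⟨t.1.1, Finset.mem_image_of_mem _ t.2⟩
  let β : (K : Finset (J × S)) → (K.image Prod.fst → Fin k → ℝ) → Option K → ℝ :=
    fun K y o => o.elim ρ fun t => b t.1.2 (y ⟨t.1.1, Finset.mem_image_of_mem _ t.2⟩)
  let v : (K : Finset (J × S)) → (K.image Prod.fst → Fin k → ℝ) → Fin k → ℝ :=
    fun K y => minNormSolution (A K y) (β K y)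
  let R : Set ((Fin k → ℝ) × (Fin k → ℝ)) :=
    {q | q.1 i = ρ ∧ ∀ σ, s σ * (q.2 ⬝ᵥ q.1) ≤ b σ q.2}
  let Ev : Finset (J × S) → Set (J → Fin k → ℝ) := fun K =>
    {W | ∀ j ∉ K.image Prod.fst, (v K (fun j : K.image Prod.fst => W j), W j) ∈ R}
  have hR : MeasurableSet R := by
    have : R = {q : (Fin k → ℝ) × (Fin k → ℝ) | q.1 i = ρ} ∩
        ⋂ σ, {q | s σ * (q.2 ⬝ᵥ q.1) ≤ b σ q.2} := by ext; simp [R]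
    rw [this]
    refine MeasurableSet.inter ?_ (MeasurableSet.iInter fun σ => ?_)
    · exact measurableSet_eq_fun (by fun_prop) measurable_const
    · refine measurableSet_le ?_ ((hb σ).comp measurable_snd)
      simp only [dotProduct]
      fun_prop
  have hv : ∀ K, Measurable (v K) := by
    intro K
    refine measurable_minNormSolution (fun o l => ?_) fun o => ?_
    · cases o with
      | none => exact measurable_const
      | some t =>
        simp only [A, Option.elim_some, Pi.smul_apply, smul_eq_mul]
        fun_prop
    · cases o with
      | none => exact measurable_const
      | some t => exact (hb _).comp (measurable_pi_apply _)
  have hsub : {W : J → Fin k → ℝ |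
        ∃ x : Fin k → ℝ, x i = ρ ∧ ∀ j σ, s σ * (W j ⬝ᵥ x) ≤ b σ (W j)} ⊆
      ⋃ K ∈ Finset.univ.filter fun K : Finset (J × S) => K.card < k, Ev K := by
    rintro W ⟨x, hxi, hx⟩
    let D := dotProductEquiv ℝ (Fin k)
    have hne : D (Pi.single i 1) ≠ 0 := by
      rw [Ne, LinearEquiv.map_eq_zero_iff]
      intro h
      simpa using congrFun h i
    obtain ⟨K, hK, hall⟩ := exists_linearIndependent_tight (D (Pi.single i 1)) hne
      (fun t : J × S => D (s t.2 • W t.1)) (fun t => b t.2 (W t.1)) x (by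
        rintro ⟨j, σ⟩
        simpa [D] using hx j σ)
    have hlin : LinearIndependent ℝ (A K fun j => W j) := by
      refine LinearIndependent.of_comp D.toLinearMap ?_
      convert hK using 1
      ext o : 1
      cases o <;> rfl
    -- Together with the coordinate functional there are |K| + 1 independent vectors in dimension k.
    have hcard : K.card < k := by
      have := hlin.fintype_card_le_finrank
      simpa using this
    have hsolve := dotProduct_minNormSolution hlin (β K fun j => W j)
    have hvi : v K (fun j => W j) i = ρ := by
      have := hsolve none
      simpa [A, β] using this
    have hfeas := hall (v K fun j => W j) (by simpa [D, hxi] using hvi) (by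
      intro t ht
      exact hsolve (some ⟨t, ht⟩))
    simp only [Set.mem_iUnion]
    refine ⟨K, by simpa using hcard, fun j _ => ⟨hvi, fun σ => ?_⟩⟩
    simpa [D] using hfeas (j, σ)
  refine (measure_mono hsub).trans ((measure_biUnion_finset_le _ _).trans
    (Finset.sum_le_sum fun K _ => ?_))
  refine (measure_pi_forall_notMem_le ν (K.image Prod.fst) (hv K) hR (p := p) ?_).trans ?_
  · intro y
    -- For dependent rows the formula may give a point off the hyperplane. The first clause of `R`
    -- makes the event empty in that case.
    by_cases h : v K y i = ρ
    · simpa [R, h] using hp _ h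
    · simp [R, h]
  · exact pow_le_pow_right_of_le_one' hp1 (Nat.sub_le_sub_left Finset.card_image_le _)

/-! ### One-dimensional estimates for Gaussian rows -/

/-- The law of a vector with independent standard Gaussian entries. -/
noncomputable abbrev gaussianRow (k : ℕ) : Measure (Fin k → ℝ) :=
  Measure.pi fun _ => gaussianReal 0 1

theorem measurable_dotProduct_const {k : ℕ} (v : Fin k → ℝ) :
    Measurable fun w : Fin k → ℝ => w ⬝ᵥ v := by
  simp only [dotProduct]
  fun_prop

/-- The characteristic function factors over the coordinates, and the exponents add up to the
squared Euclidean norm. -/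
theorem map_dotProduct_gaussianRow {k : ℕ} (v : Fin k → ℝ) :
    (gaussianRow k).map (fun w => w ⬝ᵥ v) = gaussianReal 0 (‖WithLp.toLp 2 v‖₊ ^ 2) := by
  have hmeas := measurable_dotProduct_const v
  have : IsProbabilityMeasure ((gaussianRow k).map fun w => w ⬝ᵥ v) :=
    Measure.isProbabilityMeasure_map hmeas.aemeasurable
  apply Measure.ext_of_charFun
  ext t
  rw [charFun_apply_real, integral_map hmeas.aemeasurable (by fun_prop), charFun_gaussianReal]
  have h1 : ∀ w : Fin k → ℝ, Complex.exp (t * ((w ⬝ᵥ v : ℝ) : ℂ) * Complex.I) =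
      ∏ l, Complex.exp (((t * v l : ℝ) : ℂ) * (w l : ℂ) * Complex.I) := by
    intro w
    rw [← Complex.exp_sum]
    congr 1
    simp only [dotProduct, Complex.ofReal_sum, Complex.ofReal_mul, Finset.mul_sum, Finset.sum_mul]
    refine Finset.sum_congr rfl fun l _ => ?_
    ring
  simp_rw [h1]
  rw [integral_fintype_prod_eq_prod (μ := fun _ : Fin k => gaussianReal 0 1)
    (fun l (x : ℝ) => Complex.exp (((t * v l : ℝ) : ℂ) * (x : ℂ) * Complex.I))]
  have h2 : ∀ l, ∫ x : ℝ, Complex.exp (((t * v l : ℝ) : ℂ) * (x : ℂ) * Complex.I)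
      ∂(gaussianReal 0 1) = Complex.exp (-((t * v l : ℝ) : ℂ) ^ 2 / 2) := by
    intro l
    rw [← charFun_apply_real, charFun_gaussianReal]
    congr 1
    simp
    ring
  simp_rw [h2]
  rw [← Complex.exp_sum]
  congr 1
  have h3 : ((‖WithLp.toLp 2 v‖₊ ^ 2 : ℝ≥0) : ℝ) = ∑ l, v l ^ 2 := by
    push_cast
    rw [EuclideanSpace.norm_sq_eq]
    simp
  have h4 : (((‖WithLp.toLp 2 v‖₊ ^ 2 : ℝ≥0) : ℝ) : ℂ) = ∑ l, (v l : ℂ) ^ 2 := by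
    rw [h3]; push_cast; rfl
  rw [h4]
  simp only [Complex.ofReal_mul, Complex.ofReal_zero, mul_zero, zero_mul, zero_sub,
    Finset.sum_mul, ← Finset.sum_neg_distrib, Finset.sum_div]
  refine Finset.sum_congr rfl fun l _ => ?_
  ring

/-- The density is at most 1/(2s), since √(2π) ≥ 2. -/
theorem gaussianReal_Icc_le {s : ℝ≥0} (hs : 0 < s) (a b : ℝ) :
    gaussianReal 0 (s ^ 2) (Set.Icc a b) ≤ ENNReal.ofReal ((b - a) / (2 * s)) := by
  have hs2 : s ^ 2 ≠ 0 := by positivity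
  have hs' : (0 : ℝ) < s := hs
  rw [gaussianReal_apply 0 hs2]
  have hpdf : ∀ x, gaussianPDF 0 (s ^ 2) x ≤ ENNReal.ofReal (1 / (2 * s)) := by
    intro x
    refine ENNReal.ofReal_le_ofReal ?_
    rw [gaussianPDFReal_def]
    have h1 : Real.exp (-(x - 0) ^ 2 / (2 * (s ^ 2 : ℝ≥0))) ≤ 1 := by
      rw [Real.exp_le_one_iff]
      apply div_nonpos_of_nonpos_of_nonneg
      · nlinarith [sq_nonneg (x - 0)]
      · positivity
    have h2 : 2 * (s : ℝ) ≤ √(2 * Real.pi * ((s ^ 2 : ℝ≥0) : ℝ)) := by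
      apply Real.le_sqrt_of_sq_le
      push_cast
      nlinarith [Real.pi_gt_three, sq_nonneg (s : ℝ)]
    calc _ ≤ (√(2 * Real.pi * ((s ^ 2 : ℝ≥0) : ℝ)))⁻¹ * 1 :=
          mul_le_mul_of_nonneg_left h1 (by positivity)
      _ ≤ 1 / (2 * s) := by
          rw [mul_one, one_div]
          exact inv_anti₀ (by positivity) h2
  calc _ ≤ ∫⁻ _ in Set.Icc a b, ENNReal.ofReal (1 / (2 * s)) := lintegral_mono fun x => hpdf x
    _ = ENNReal.ofReal (1 / (2 * s)) * ENNReal.ofReal (b - a) := by simp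
    _ = _ := by
      rw [← ENNReal.ofReal_mul (by positivity)]
      congr 1
      ring

theorem gaussianReal_Iio_zero_le (v : ℝ≥0) : gaussianReal 0 v (Set.Iio 0) ≤ 1 / 2 := by
  have h1 : gaussianReal 0 v (Set.Ioi 0) = gaussianReal 0 v (Set.Iio 0) := by
    have h := gaussianReal_map_neg (μ := 0) (v := v)
    rw [neg_zero] at h
    conv_lhs => rw [← h, Measure.map_apply measurable_neg measurableSet_Ioi]
    congr 1
    ext x
    simp
  have h2 : gaussianReal 0 v (Set.Iio 0) + gaussianReal 0 v (Set.Ioi 0) ≤ 1 := by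
    rw [← measure_union (by
      rw [Set.disjoint_left]
      intro x h h'
      exact lt_asymm (Set.mem_Iio.1 h) (Set.mem_Ioi.1 h')) measurableSet_Ioi]
    exact prob_le_one
  rw [h1, ← two_mul] at h2
  rw [ENNReal.le_div_iff_mul_le (by simp) (by simp), mul_comm]
  exact h2

theorem gaussianReal_Iic_le {s : ℝ≥0} (hs : 0 < s) (a : ℝ) (ha : 0 ≤ a) :
    gaussianReal 0 (s ^ 2) (Set.Iic a) ≤ ENNReal.ofReal (1 / 2 + a / (2 * s)) := by
  have : Set.Iic a ⊆ Set.Iio 0 ∪ Set.Icc 0 a := by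
    intro x hx
    rcases lt_or_ge x 0 with h | h
    · exact Or.inl h
    · exact Or.inr ⟨h, hx⟩
  refine (measure_mono this).trans ((measure_union_le _ _).trans ?_)
  rw [ENNReal.ofReal_add (by norm_num) (by positivity)]
  refine add_le_add ?_ ?_
  · refine (gaussianReal_Iio_zero_le _).trans_eq ?_
    rw [ENNReal.ofReal_div_of_pos (by norm_num)]
    simp
  · simpa using gaussianReal_Icc_le hs 0 a

theorem gaussianReal_Ioi_le {K : ℝ} (hK : 0 < K) :
    gaussianReal 0 1 (Set.Ioi K) ≤ ENNReal.ofReal (1 / K ^ 2) := by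
  have h := meas_ge_le_variance_div_sq (μ := gaussianReal 0 1) (X := id)
    (memLp_id_gaussianReal' 2 (by simp)) hK
  rw [variance_id_gaussianReal] at h
  refine (measure_mono ?_).trans (h.trans_eq (by simp))
  intro x hx
  simp only [id, integral_id_gaussianReal, sub_zero, Set.mem_ofPred_eq]
  exact (le_of_lt hx).trans (le_abs_self x)

theorem abs_apply_le_euclidean_norm {k : ℕ} (v : Fin k → ℝ) (i : Fin k) :
    |v i| ≤ ‖WithLp.toLp 2 v‖ := by
  simpa using PiLp.norm_apply_le (WithLp.toLp 2 v) i

theorem gaussianRow_abs_dotProduct_le {k : ℕ} {v : Fin k → ℝ} (hv : 1 ≤ ‖WithLp.toLp 2 v‖)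
    {c : ℝ} (hc : 0 ≤ c) :
    gaussianRow k {w | |w ⬝ᵥ v| ≤ c} ≤ ENNReal.ofReal c := by
  have hpos : 0 < ‖WithLp.toLp 2 v‖₊ := lt_of_lt_of_le one_pos hv
  have h := gaussianReal_Icc_le hpos (-c) c
  rw [← map_dotProduct_gaussianRow, Measure.map_apply (measurable_dotProduct_const v)
    measurableSet_Icc] at h
  have hset : {w : Fin k → ℝ | |w ⬝ᵥ v| ≤ c} = (fun w => w ⬝ᵥ v) ⁻¹' Set.Icc (-c) c := by
    ext w
    simp [abs_le]
  rw [hset]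
  refine h.trans (ENNReal.ofReal_le_ofReal ?_)
  rw [div_le_iff₀ (by positivity), coe_nnnorm]
  nlinarith

theorem gaussianRow_dotProduct_le {k : ℕ} {v : Fin k → ℝ} (hv : 0 < ‖WithLp.toLp 2 v‖)
    {a : ℝ} (ha : 0 ≤ a) :
    gaussianRow k {w | w ⬝ᵥ v ≤ a} ≤ ENNReal.ofReal (1 / 2 + a / (2 * ‖WithLp.toLp 2 v‖)) := by
  have hpos : 0 < ‖WithLp.toLp 2 v‖₊ := hv
  have h := gaussianReal_Iic_le hpos a ha
  rw [← map_dotProduct_gaussianRow, Measure.map_apply (measurable_dotProduct_const v)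
    measurableSet_Iic] at h
  exact h

theorem gaussianRow_lt_dotProduct_le {k : ℕ} {u : Fin k → ℝ} (hu : ‖WithLp.toLp 2 u‖ = 1)
    {K : ℝ} (hK : 0 < K) :
    gaussianRow k {w | K < w ⬝ᵥ u} ≤ ENNReal.ofReal (1 / K ^ 2) := by
  have hu' : ‖WithLp.toLp 2 u‖₊ = 1 := NNReal.eq hu
  have h := gaussianReal_Ioi_le hK
  have h1 := map_dotProduct_gaussianRow u
  rw [hu', one_pow] at h1
  rw [← h1, Measure.map_apply (measurable_dotProduct_const u) measurableSet_Ioi] at h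
  exact h

/-- The bound on the radius of the feasible region of the linear program of the first layer. -/
noncomputable abbrev feasibleRadius : ℝ := 2000000

/-- By Chebyshev, ⟨w, u⟩ > 10 costs 1/100. Otherwise the right side is at most 10002, and a
symmetric Gaussian of scale `feasibleRadius` stays below that with probability at most 1/2 + 1/100.
The total is 13/25. -/
theorem gaussianRow_relaxed_constraint_le {k : ℕ} {u v : Fin k → ℝ} (hu : ‖WithLp.toLp 2 u‖ = 1)
    (hv : feasibleRadius ≤ ‖WithLp.toLp 2 v‖) :
    gaussianRow k {w | w ⬝ᵥ v ≤ 2 + 1000 * max (w ⬝ᵥ u) 0} ≤ ENNReal.ofReal (13 / 25) := by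
  have hsub : {w : Fin k → ℝ | w ⬝ᵥ v ≤ 2 + 1000 * max (w ⬝ᵥ u) 0} ⊆
      {w | 10 < w ⬝ᵥ u} ∪ {w | w ⬝ᵥ v ≤ 10002} := by
    intro w hw
    rw [Set.mem_union]
    by_contra hcon
    push Not at hcon
    simp only [Set.mem_ofPred_eq, not_lt, not_le] at hcon hw
    have : max (w ⬝ᵥ u) 0 ≤ 10 := max_le hcon.1 (by norm_num)
    linarith [hcon.2]
  have hpos : 0 < ‖WithLp.toLp 2 v‖ := lt_of_lt_of_le (by norm_num) hv
  refine (measure_mono hsub).trans ((measure_union_le _ _).trans ((add_le_add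
    (gaussianRow_lt_dotProduct_le hu (by norm_num : (0 : ℝ) < 10))
    (gaussianRow_dotProduct_le hpos (by norm_num : (0 : ℝ) ≤ 10002))).trans ?_))
  rw [← ENNReal.ofReal_add (by norm_num) (by positivity)]
  refine ENNReal.ofReal_le_ofReal ?_
  have : (10002 : ℝ) / (2 * ‖WithLp.toLp 2 v‖) ≤ 1 / 100 := by
    rw [div_le_iff₀ (by positivity)]
    linarith
  linarith

/-! ### Two polyhedra with Gaussian rows -/

/-- With high probability a Gaussian matrix with sufficiently many rows extends the sup norm. -/
theorem measure_pi_exists_small_le {J : Type*} [Fintype J] [DecidableEq J] {k : ℕ} {c : ℝ}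
    (hc0 : 0 ≤ c) (hc1 : c ≤ 1) (hk : k ≤ Fintype.card J) :
    Measure.pi (fun _ : J => gaussianRow k)
        {W | ∃ x : Fin k → ℝ, x ≠ 0 ∧ ∀ j, |W j ⬝ᵥ x| ≤ c * ‖x‖} ≤
      ENNReal.ofReal (k * (4 ^ Fintype.card J * c ^ (Fintype.card J - k))) := by
  classical
  -- A slab is two one-sided constraints, so there are 2N constraints and at most 4^N selections.
  let s : Bool → ℝ := fun σ => if σ then 1 else -1
  have hone : ∀ i : Fin k, Measure.pi (fun _ : J => gaussianRow k)
      {W | ∃ x : Fin k → ℝ, x i = 1 ∧ ∀ j σ, s σ * (W j ⬝ᵥ x) ≤ c} ≤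
      ENNReal.ofReal (4 ^ Fintype.card J * c ^ (Fintype.card J - k)) := by
    intro i
    refine (measure_pi_exists_feasible_le (gaussianRow k) s (b := fun _ _ => c)
      (fun _ => measurable_const) i 1 (p := ENNReal.ofReal c) (by simpa using hc1) ?_).trans ?_
    · intro v hv
      have h1 : 1 ≤ ‖WithLp.toLp 2 v‖ := by
        have := abs_apply_le_euclidean_norm v i
        rwa [hv, abs_one] at this
      refine (measure_mono ?_).trans (gaussianRow_abs_dotProduct_le h1 hc0)
      intro w hw
      have h1 := hw true
      have h2 := hw false
      simp only [s, if_true, Bool.false_eq_true, if_false] at h1 h2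
      rw [Set.mem_ofPred_eq, abs_le]
      constructor <;> linarith
    · have hterm : ∀ K ∈ Finset.univ.filter fun K : Finset (J × Bool) => K.card < k,
          ENNReal.ofReal c ^ (Fintype.card J - K.card) ≤
            ENNReal.ofReal (c ^ (Fintype.card J - k)) := by
        intro K hK
        rw [Finset.mem_filter] at hK
        rw [← ENNReal.ofReal_pow hc0]
        exact ENNReal.ofReal_le_ofReal (pow_le_pow_of_le_one hc0 hc1 (by omega))
      refine (Finset.sum_le_card_nsmul _ _ _ hterm).trans ?_
      rw [nsmul_eq_mul, ENNReal.ofReal_mul (by positivity)]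
      refine mul_le_mul_left ?_ _
      rw [← ENNReal.ofReal_natCast]
      refine ENNReal.ofReal_le_ofReal ?_
      have h4 : (Finset.univ.filter fun K : Finset (J × Bool) => K.card < k).card ≤
          4 ^ Fintype.card J := by
        refine (Finset.card_le_univ _).trans_eq ?_
        rw [Fintype.card_finset, Fintype.card_prod, Fintype.card_bool, mul_comm, pow_mul]
        norm_num
      exact_mod_cast h4
  have hsub : {W : J → Fin k → ℝ | ∃ x : Fin k → ℝ, x ≠ 0 ∧ ∀ j, |W j ⬝ᵥ x| ≤ c * ‖x‖} ⊆
      ⋃ i ∈ (Finset.univ : Finset (Fin k)),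
        {W | ∃ x : Fin k → ℝ, x i = 1 ∧ ∀ j σ, s σ * (W j ⬝ᵥ x) ≤ c} := by
    rintro W ⟨x, hx0, hx⟩
    have hne : Nonempty (Fin k) := by
      by_contra h
      rw [not_nonempty_iff] at h
      exact hx0 (Subsingleton.elim _ _)
    obtain ⟨i, hi⟩ : ∃ i, ‖x‖ = |x i| := by
      obtain ⟨i, hi⟩ := Finite.exists_max fun i => |x i|
      exact ⟨i, le_antisymm ((pi_norm_le_iff_of_nonneg (abs_nonneg _)).2 hi)
        (norm_le_pi_norm x i)⟩
    have hxi : 0 < |x i| := by rw [← hi]; exact norm_pos_iff.2 hx0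
    simp only [Set.mem_iUnion]
    refine ⟨i, Finset.mem_univ _, (x i)⁻¹ • x, by simp [abs_pos.1 hxi], fun j σ => ?_⟩
    have h1 : |W j ⬝ᵥ ((x i)⁻¹ • x)| ≤ c := by
      rw [dotProduct_smul, smul_eq_mul, abs_mul, abs_inv, inv_mul_le_iff₀ hxi, mul_comm, ← hi]
      exact hx j
    rw [abs_le] at h1
    cases σ
    · simp only [s, Bool.false_eq_true, if_false]; linarith [h1.1]
    · simp only [s, if_true]; linarith [h1.2]
  refine (measure_mono hsub).trans ((measure_biUnion_finset_le _ _).trans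
    ((Finset.sum_le_card_nsmul _ _ _ fun i _ => hone i).trans_eq ?_))
  rw [nsmul_eq_mul, ENNReal.ofReal_mul (by positivity)]
  simp

/-- With high probability, the polyhedron `{x | ⟨w_j, x⟩ ≤ 2 + 1000 ⟨w_j, u⟩₊ for all j}` of a
Gaussian matrix is contained in a ball of fixed radius. -/
theorem measure_pi_exists_large_le {J : Type*} [Fintype J] [DecidableEq J] {k : ℕ}
    {u : Fin k → ℝ} (hu : ‖WithLp.toLp 2 u‖ = 1) :
    Measure.pi (fun _ : J => gaussianRow k)
        {W | ∃ x : Fin k → ℝ, feasibleRadius ≤ ‖x‖ ∧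
          ∀ j, W j ⬝ᵥ x ≤ 2 + 1000 * max (W j ⬝ᵥ u) 0} ≤
      ENNReal.ofReal (2 * k * (8 ^ k * (129 / 200) ^ Fintype.card J)) := by
  classical
  let P : ℝ → Fin k → Set (J → Fin k → ℝ) := fun ρ i =>
    {W | ∃ x : Fin k → ℝ, x i = ρ ∧ ∀ j (_ : Unit), 1 * (W j ⬝ᵥ x) ≤ 2 + 1000 * max (W j ⬝ᵥ u) 0}
  have hone : ∀ (i : Fin k) (ρ : ℝ), |ρ| = feasibleRadius →
      Measure.pi (fun _ : J => gaussianRow k) (P ρ i) ≤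
      ENNReal.ofReal (8 ^ k * (129 / 200) ^ Fintype.card J) := by
    intro i ρ hρ
    refine (measure_pi_exists_feasible_le (gaussianRow k) (fun _ : Unit => 1)
      (b := fun _ w => 2 + 1000 * max (w ⬝ᵥ u) 0)
      (fun _ => by have := measurable_dotProduct_const u; fun_prop) i ρ
      (p := ENNReal.ofReal (13 / 25)) (by norm_num) ?_).trans ?_
    · intro v hv
      have h1 : feasibleRadius ≤ ‖WithLp.toLp 2 v‖ := by
        have := abs_apply_le_euclidean_norm v i
        rwa [hv, hρ] at this
      refine (measure_mono ?_).trans (gaussianRow_relaxed_constraint_le hu h1)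
      intro w hw
      simpa using hw ()
    -- Since |K| < k, inserting 8^k (1/8)^|K| ≥ 1 turns the restricted sum into the binomial sum 8^k
    -- (1/8 + 13/25)^N, and 1/8 + 13/25 = 129/200.
    · have hterm : ∀ K ∈ Finset.univ.filter fun K : Finset (J × Unit) => K.card < k,
          ENNReal.ofReal (13 / 25) ^ (Fintype.card J - K.card) ≤
            ENNReal.ofReal (8 ^ k * ((1 / 8) ^ K.card *
              (13 / 25) ^ (Fintype.card J - K.card))) := by
        intro K hK
        rw [Finset.mem_filter] at hK
        rw [← ENNReal.ofReal_pow (by norm_num)]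
        refine ENNReal.ofReal_le_ofReal ?_
        rw [← mul_assoc]
        refine le_mul_of_one_le_left (by positivity) ?_
        rw [one_div, inv_pow, ← div_eq_mul_inv, one_le_div (by positivity)]
        exact pow_le_pow_right₀ (by norm_num) hK.2.le
      refine (Finset.sum_le_sum hterm).trans ?_
      refine (Finset.sum_le_sum_of_subset (Finset.filter_subset _ _)).trans ?_
      rw [← ENNReal.ofReal_sum_of_nonneg (fun _ _ => by positivity), ← Finset.mul_sum]
      have hsum := Fintype.sum_pow_mul_eq_add_pow (J × Unit) (1 / 8 : ℝ) (13 / 25)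
      rw [Fintype.card_prod, Fintype.card_unit, mul_one] at hsum
      rw [hsum]
      norm_num
  have hsub : {W : J → Fin k → ℝ | ∃ x : Fin k → ℝ, feasibleRadius ≤ ‖x‖ ∧
          ∀ j, W j ⬝ᵥ x ≤ 2 + 1000 * max (W j ⬝ᵥ u) 0} ⊆
      ⋃ i ∈ (Finset.univ : Finset (Fin k)), (P feasibleRadius i ∪ P (-feasibleRadius) i) := by
    rintro W ⟨x, hxR, hx⟩
    have hne : Nonempty (Fin k) := by
      by_contra h
      rw [not_nonempty_iff] at h
      rw [Subsingleton.elim x 0, norm_zero] at hxR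
      norm_num [feasibleRadius] at hxR
    obtain ⟨i, hi⟩ := Finite.exists_max fun i => |x i|
    have hxi : feasibleRadius ≤ |x i| :=
      hxR.trans ((pi_norm_le_iff_of_nonneg (abs_nonneg _)).2 hi)
    have hpos : 0 < |x i| := lt_of_lt_of_le (by norm_num) hxi
    -- The polyhedron is star-shaped about 0, so a far point can be shrunk until its largest
    -- coordinate is exactly ± the radius.
    have hfeas : ∀ j (_ : Unit), 1 * (W j ⬝ᵥ ((feasibleRadius / |x i|) • x)) ≤
        2 + 1000 * max (W j ⬝ᵥ u) 0 := by
      intro j _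
      have hr1 : feasibleRadius / |x i| ≤ 1 := (div_le_one hpos).2 hxi
      have hr0 : 0 ≤ feasibleRadius / |x i| := by positivity
      rw [dotProduct_smul, smul_eq_mul, one_mul]
      have hb : 0 ≤ 2 + 1000 * max (W j ⬝ᵥ u) 0 := by positivity
      nlinarith [hx j, mul_le_mul_of_nonneg_left (hx j) hr0]
    simp only [Set.mem_iUnion]
    refine ⟨i, Finset.mem_univ _, ?_⟩
    rcases le_total 0 (x i) with h | h
    · refine Or.inl ⟨_, ?_, hfeas⟩
      rw [abs_of_nonneg h] at hpos
      simp [abs_of_nonneg h, hpos.ne']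
    · refine Or.inr ⟨_, ?_, hfeas⟩
      rw [abs_of_nonpos h] at hpos
      have : x i ≠ 0 := by linarith
      rw [Pi.smul_apply, smul_eq_mul, abs_of_nonpos h]
      field_simp
  refine (measure_mono hsub).trans ((measure_biUnion_finset_le _ _).trans
    ((Finset.sum_le_card_nsmul _ _ (2 * ENNReal.ofReal
      (8 ^ k * (129 / 200) ^ Fintype.card J)) fun i _ => ?_).trans_eq ?_))
  · rw [two_mul]
    exact (measure_union_le _ _).trans (add_le_add (hone i _ (by norm_num [feasibleRadius]))
      (hone i _ (by norm_num [feasibleRadius])))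
  · rw [nsmul_eq_mul, ENNReal.ofReal_mul (by positivity), ENNReal.ofReal_mul (by positivity)]
    simp
    ring

/-! ### Many large coordinates -/

/-- A Chernoff bound: if each of `N` independent rows lies in `A` with probability at most `251/500`,
then the probability that at least `3N/5` of them do is exponentially small. -/
theorem measure_pi_card_ge_le {J E : Type*} [Fintype J] [DecidableEq J] [MeasurableSpace E]
    (ν : Measure E) [IsProbabilityMeasure ν] {A : Set E} [DecidablePred (· ∈ A)]
    (hA : ν A ≤ ENNReal.ofReal (251 / 500)) (hAm : MeasurableSet A) :
    Measure.pi (fun _ : J => ν)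
        {W | 3 * Fintype.card J ≤ 5 * (Finset.univ.filter fun j => W j ∈ A).card} ≤
      ENNReal.ofReal ((99 / 100) ^ Fintype.card J) := by
  classical
  set N := Fintype.card J with hN
  set a := ν.real A with ha
  have ha0 : 0 ≤ a := measureReal_nonneg
  have haν : ν A = ENNReal.ofReal a := by simp [ha]
  have ha1 : a ≤ 251 / 500 := by
    rw [haν] at hA
    exact (ENNReal.ofReal_le_ofReal_iff (by norm_num)).1 hA
  have hac : ν Aᶜ = ENNReal.ofReal (1 - a) := by
    rw [prob_compl_eq_one_sub hAm, haν, ENNReal.ofReal_sub _ ha0, ENNReal.ofReal_one]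
  have hsub : {W : J → E | 3 * N ≤ 5 * (Finset.univ.filter fun j => W j ∈ A).card} ⊆
      ⋃ F ∈ Finset.univ.filter fun F : Finset J => 3 * N ≤ 5 * F.card,
        Set.pi Set.univ fun j => if j ∈ F then A else Aᶜ := by
    intro W hW
    simp only [Set.mem_iUnion]
    refine ⟨Finset.univ.filter fun j => W j ∈ A, by simpa using hW, fun j _ => ?_⟩
    by_cases h : W j ∈ A <;> simp [h]
  -- Exponential tilting by 3/2: the tilted binomial sum is (1 + a/2)^N, at most 1.255^N because a ≤
  -- 251/500.
  have hterm : ∀ F ∈ Finset.univ.filter fun F : Finset J => 3 * N ≤ 5 * F.card,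
      Measure.pi (fun _ : J => ν) (Set.pi Set.univ fun j => if j ∈ F then A else Aᶜ) ≤
        ENNReal.ofReal (((99 / 100) / (125.5 / 100)) ^ N *
          ((3 / 2 * a) ^ F.card * (1 - a) ^ (N - F.card))) := by
    intro F hF
    have hF' : 3 * N ≤ 5 * F.card := by simpa using hF
    have hval : Measure.pi (fun _ : J => ν) (Set.pi Set.univ fun j => if j ∈ F then A else Aᶜ) =
        ENNReal.ofReal (a ^ F.card * (1 - a) ^ (N - F.card)) := by
      rw [Measure.pi_pi]
      have : ∀ j, ν (if j ∈ F then A else Aᶜ) =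
          if j ∈ F then ENNReal.ofReal a else ENNReal.ofReal (1 - a) := by
        intro j
        split_ifs
        · exact haν
        · exact hac
      simp_rw [this]
      rw [Finset.prod_ite, Finset.prod_const, Finset.prod_const, ENNReal.ofReal_mul (by positivity),
        ENNReal.ofReal_pow ha0, ENNReal.ofReal_pow (by linarith)]
      congr 2
      · simp
      · rw [Finset.filter_not, Finset.card_sdiff_of_subset (Finset.filter_subset _ _)]
        simp [hN]
    rw [hval]
    refine ENNReal.ofReal_le_ofReal ?_
    have h1a : 0 ≤ 1 - a := by linarith
    have hfac : 1 ≤ ((99 / 100) / (125.5 / 100) : ℝ) ^ N * (3 / 2) ^ F.card := by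
      -- Fifth powers avoid the fractional exponent 3N/5.
      have h5 : 1 ≤ (((99 / 100) / (125.5 / 100) : ℝ) ^ N * (3 / 2) ^ F.card) ^ 5 := by
        calc (1 : ℝ) ≤ (((99 / 100) / (125.5 / 100)) ^ 5 * (3 / 2) ^ 3) ^ N :=
              one_le_pow₀ (by norm_num)
          _ = (((99 / 100) / (125.5 / 100)) ^ N) ^ 5 * (3 / 2) ^ (3 * N) := by
              rw [mul_pow, ← pow_mul, ← pow_mul, ← pow_mul, mul_comm 5 N]
          _ ≤ (((99 / 100) / (125.5 / 100)) ^ N) ^ 5 * (3 / 2) ^ (5 * F.card) := by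
              gcongr
              norm_num
          _ = _ := by rw [mul_pow, ← pow_mul (3 / 2 : ℝ), mul_comm 5 F.card]
      by_contra hlt
      push Not at hlt
      exact absurd h5 (not_le.2 (pow_lt_one₀ (by positivity) hlt (by norm_num)))
    calc a ^ F.card * (1 - a) ^ (N - F.card)
        ≤ (((99 / 100) / (125.5 / 100) : ℝ) ^ N * (3 / 2) ^ F.card) *
          (a ^ F.card * (1 - a) ^ (N - F.card)) := le_mul_of_one_le_left (by positivity) hfac
      _ = _ := by rw [mul_pow]; ring
  refine (measure_mono hsub).trans ((measure_biUnion_finset_le _ _).trans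
    ((Finset.sum_le_sum hterm).trans
      ((Finset.sum_le_sum_of_subset (Finset.filter_subset _ _)).trans ?_)))
  have h1a : 0 ≤ 1 - a := by linarith
  rw [← ENNReal.ofReal_sum_of_nonneg (fun _ _ => by positivity), ← Finset.mul_sum,
    Fintype.sum_pow_mul_eq_add_pow J]
  refine ENNReal.ofReal_le_ofReal ?_
  rw [← mul_pow]
  refine pow_le_pow_left₀ (by positivity) ?_ _
  rw [div_mul_eq_mul_div, div_le_iff₀ (by norm_num)]
  nlinarith

/-- The image of a nonzero vector under a Gaussian matrix has many large coordinates. -/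
theorem measure_pi_card_large_lt_le {J : Type*} [Fintype J] [DecidableEq J] {k m : ℕ}
    (hm : 5 * m ≤ 2 * Fintype.card J) {y : Fin k → ℝ} (hy : y ≠ 0) :
    Measure.pi (fun _ : J => gaussianRow k)
        {W | (Finset.univ.filter fun j => 1 / 500 * ‖WithLp.toLp 2 y‖ < W j ⬝ᵥ y).card < m} ≤
      ENNReal.ofReal ((99 / 100) ^ Fintype.card J) := by
  classical
  let A : Set (Fin k → ℝ) := {w | w ⬝ᵥ y ≤ 1 / 500 * ‖WithLp.toLp 2 y‖}
  have hAm : MeasurableSet A := measurableSet_le (measurable_dotProduct_const y) measurable_const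
  have hpos : 0 < ‖WithLp.toLp 2 y‖ := by
    rw [norm_pos_iff]
    simpa using hy
  have hA : gaussianRow k A ≤ ENNReal.ofReal (251 / 500) := by
    refine (gaussianRow_dotProduct_le hpos (by positivity)).trans (ENNReal.ofReal_le_ofReal ?_)
    have : 1 / 500 * ‖WithLp.toLp 2 y‖ / (2 * ‖WithLp.toLp 2 y‖) = 1 / 1000 := by
      field_simp
      norm_num
    rw [this]
    norm_num
  refine (measure_mono ?_).trans (measure_pi_card_ge_le (gaussianRow k) hA hAm)
  intro W hW
  have hW' : (Finset.univ.filter fun j => 1 / 500 * ‖WithLp.toLp 2 y‖ < W j ⬝ᵥ y).card < m := hW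
  have hcompl : (Finset.univ.filter fun j => W j ∈ A) =
      (Finset.univ.filter fun j => 1 / 500 * ‖WithLp.toLp 2 y‖ < W j ⬝ᵥ y)ᶜ := by
    ext j
    simp [A]
  rw [Set.mem_ofPred_eq, hcompl, Finset.card_compl]
  omega

/-! ### Deterministic analysis of one linear program -/

theorem exists_isLPSolution {N k : ℕ} {A : Matrix (Fin N) (Fin k) ℝ} {x : Fin N → ℝ} {ε B : ℝ}
    (hne : ∃ z δ, LPFeasible A x ε z δ)
    (hB : ∀ z δ, LPFeasible A x ε z δ → ‖z‖ ≤ B ∧ -B ≤ δ) : ∃ z, IsLPSolution A x ε z := by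
  let F : Set ((Fin k → ℝ) × ℝ) := {q | LPFeasible A x ε q.1 q.2}
  have hcont : ∀ j, Continuous fun q : (Fin k → ℝ) × ℝ => (A.mulVec q.1) j := fun j =>
    (continuous_apply j).comp (Continuous.matrix_mulVec continuous_const continuous_fst)
  have hclosed : IsClosed F := by
    have : F = (⋂ j, ⋂ (_ : ε < x j), {q | x j - q.2 ≤ (A.mulVec q.1) j} ∩
        {q | (A.mulVec q.1) j ≤ x j + q.2}) ∩
        ((⋂ j, ⋂ (_ : x j ≤ ε), {q | (A.mulVec q.1) j ≤ x j + q.2}) ∩ {q | q.2 ≤ ε}) := by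
      ext q
      simp [F, LPFeasible]
    rw [this]
    refine (isClosed_iInter fun j => isClosed_iInter fun _ => ?_).inter
      ((isClosed_iInter fun j => isClosed_iInter fun _ => ?_).inter ?_)
    · exact (isClosed_le (by fun_prop) (hcont j)).inter (isClosed_le (hcont j) (by fun_prop))
    · exact isClosed_le (hcont j) (by fun_prop)
    · exact isClosed_le (by fun_prop) (by fun_prop)
  have hcomp : IsCompact F := by
    refine IsCompact.of_isClosed_subset
      ((isCompact_closedBall (0 : Fin k → ℝ) B).prod (isCompact_Icc (a := -B) (b := ε)))
      hclosed ?_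
    intro q hq
    have := hB _ _ hq
    exact ⟨by simpa using this.1, this.2, hq.2.2⟩
  obtain ⟨z₀, δ₀, h₀⟩ := hne
  obtain ⟨q, hq, hmin⟩ := hcomp.exists_isMinOn ⟨(z₀, δ₀), h₀⟩ continuous_snd.continuousOn
  exact ⟨q.1, q.2, hq, fun z' δ' h' => hmin (show (z', δ') ∈ F from h')⟩

/-- An observation above ε forces the unit to be active, so there the ReLU is the identity.
Elsewhere only the upper constraint is imposed, and ReLU dominates its argument. -/
theorem lpFeasible_of_norm_sub_le {N k : ℕ} {A : Matrix (Fin N) (Fin k) ℝ} {x : Fin N → ℝ}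
    {ε : ℝ} {a : Fin k → ℝ} (hx : ‖x - reluLayer A a‖ ≤ ε) : LPFeasible A x ε a ε := by
  have hj : ∀ j, |x j - max ((A.mulVec a) j) 0| ≤ ε := fun j =>
    (norm_le_pi_norm (x - reluLayer A a) j).trans hx
  refine ⟨fun j h => ?_, fun j _ => ?_, le_rfl⟩
  · have h1 := abs_le.1 (hj j)
    have hpos : 0 < max ((A.mulVec a) j) 0 := by linarith [h1.2]
    have : max ((A.mulVec a) j) 0 = (A.mulVec a) j := by
      rcases le_total ((A.mulVec a) j) 0 with h' | h'
      · rw [max_eq_right h'] at hpos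
        exact absurd hpos (lt_irrefl _)
      · exact max_eq_left h'
    rw [this] at h1
    constructor <;> linarith [h1.1, h1.2]
  · have h1 := abs_le.1 (hj j)
    linarith [h1.1, le_max_left ((A.mulVec a) j) 0]

/-- One layer is inverted stably if sufficiently many output coordinates exceed twice the error. -/
theorem lp_recovers_of_rowsExtend {N k : ℕ} {A : Matrix (Fin N) (Fin k) ℝ} {x : Fin N → ℝ}
    {ε c : ℝ} {a : Fin k → ℝ} (hc : 0 < c) (hx : ‖x - reluLayer A a‖ ≤ ε)
    {I : Finset (Fin N)} (hI : I.Nonempty) (hlarge : ∀ j ∈ I, 2 * ε < (A.mulVec a) j)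
    (hext : RowsExtend A I c) :
    (∃ z, IsLPSolution A x ε z) ∧ ∀ z, IsLPSolution A x ε z → ‖z - a‖ ≤ ε * (2 / c) := by
  have hε : 0 ≤ ε := (norm_nonneg _).trans hx
  have hxj : ∀ j ∈ I, |x j - (A.mulVec a) j| ≤ ε := by
    intro j hj
    have h := (norm_le_pi_norm (x - reluLayer A a) j).trans hx
    have h2 : reluLayer A a j = (A.mulVec a) j := max_eq_left (by linarith [hlarge j hj])
    rwa [Pi.sub_apply, h2, Real.norm_eq_abs] at h
  have hfeas : ∀ z δ, LPFeasible A x ε z δ → ‖z - a‖ ≤ ε * (2 / c) ∧ 0 ≤ δ := by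
    intro z δ hz
    -- An exact value above 2ε is observed above ε, so its row carries both constraints.
    have hrow : ∀ j ∈ I, x j - δ ≤ (A.mulVec z) j ∧ (A.mulVec z) j ≤ x j + δ := fun j hj =>
      hz.1 j (by linarith [(abs_le.1 (hxj j hj)).1, hlarge j hj])
    have hδ : δ ≤ ε := hz.2.2
    constructor
    · have h1 : ‖(A.submatrix (fun j : I => (j : Fin N)) id).mulVec (z - a)‖ ≤ 2 * ε := by
        refine (pi_norm_le_iff_of_nonneg (by positivity)).2 fun j => ?_
        have h2 : (A.submatrix (fun j : I => (j : Fin N)) id).mulVec (z - a) j =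
            (A.mulVec z) j - (A.mulVec a) j := by
          rw [Matrix.mulVec_sub]
          rfl
        rw [h2, Real.norm_eq_abs, abs_le]
        have h3 := abs_le.1 (hxj j j.2)
        have h4 := hrow j j.2
        constructor <;> linarith [h3.1, h3.2, h4.1, h4.2]
      have h2 := (hext (z - a)).trans h1
      rw [mul_div_assoc', le_div_iff₀ hc]
      linarith
    · obtain ⟨j, hj⟩ := hI
      have := hrow j hj
      linarith [this.1, this.2]
  refine ⟨exists_isLPSolution (B := ε * (2 / c) + ‖a‖) ⟨a, ε, lpFeasible_of_norm_sub_le hx⟩ ?_,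
    fun z hz => ?_⟩
  · intro z δ hz
    have h := hfeas z δ hz
    constructor
    · calc ‖z‖ = ‖(z - a) + a‖ := by rw [sub_add_cancel]
        _ ≤ _ := (norm_add_le _ _).trans (by linarith [h.1])
    · have : 0 ≤ ε * (2 / c) + ‖a‖ := by positivity
      linarith [h.2]
  · obtain ⟨δ, hδ, _⟩ := hz
    exact (hfeas z δ hδ).1

theorem norm_le_euclidean_norm {k : ℕ} (v : Fin k → ℝ) : ‖v‖ ≤ ‖WithLp.toLp 2 v‖ :=
  (pi_norm_le_iff_of_nonneg (norm_nonneg _)).2 fun i => abs_apply_le_euclidean_norm v i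

/-- If the error is not small compared with the signal, the linear program still has solutions
and their distance from the signal is at most proportional to the error. -/
theorem lp_recovers_of_bounded {N k : ℕ} {A : Matrix (Fin N) (Fin k) ℝ} {x : Fin N → ℝ}
    {ε : ℝ} {a u : Fin k → ℝ} (hN : 0 < N) (hx : ‖x - reluLayer A a‖ ≤ ε)
    (hau : a = ‖WithLp.toLp 2 a‖ • u) (ha : ‖WithLp.toLp 2 a‖ ≤ 1000 * ε) (hε : 0 < ε)
    (hpoly : ∀ v : Fin k → ℝ, (∀ j, A j ⬝ᵥ v ≤ 2 + 1000 * max (A j ⬝ᵥ u) 0) →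
      ‖v‖ < feasibleRadius) :
    (∃ z, IsLPSolution A x ε z) ∧
      ∀ z, IsLPSolution A x ε z → ‖z - a‖ ≤ ε * (feasibleRadius + 1000) := by
  have hbound : ∀ z δ, LPFeasible A x ε z δ → ‖z‖ ≤ ε * feasibleRadius := by
    intro z δ hz
    have hδ : δ ≤ ε := hz.2.2
    have h1 : ∀ j, (A.mulVec z) j ≤ max ((A.mulVec a) j) 0 + 2 * ε := by
      intro j
      have h2 : (A.mulVec z) j ≤ x j + δ := by
        rcases lt_or_ge ε (x j) with h | h
        · exact (hz.1 j h).2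
        · exact hz.2.1 j h
      have h3 := abs_le.1 ((norm_le_pi_norm (x - reluLayer A a) j).trans hx)
      simp only [Pi.sub_apply, reluLayer] at h3
      linarith [h3.2]
    -- After division by ε, the slack 2ε becomes 2 and the signal contributes at most 1000 ⟨w, u⟩₊,
    -- as ‖a‖₂ ≤ 1000 ε.
    have h2 := hpoly (ε⁻¹ • z) fun j => by
      rw [dotProduct_smul, smul_eq_mul, inv_mul_le_iff₀ hε]
      have h3 : (A.mulVec a) j = ‖WithLp.toLp 2 a‖ * (A j ⬝ᵥ u) := by
        conv_lhs => rw [hau, Matrix.mulVec_smul]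
        rfl
      have h4 : max ((A.mulVec a) j) 0 ≤ 1000 * ε * max (A j ⬝ᵥ u) 0 := by
        rw [h3]
        refine max_le ?_ (by positivity)
        calc ‖WithLp.toLp 2 a‖ * (A j ⬝ᵥ u)
            ≤ ‖WithLp.toLp 2 a‖ * max (A j ⬝ᵥ u) 0 :=
              mul_le_mul_of_nonneg_left (le_max_left _ _) (norm_nonneg _)
          _ ≤ _ := mul_le_mul_of_nonneg_right ha (le_max_right _ _)
      have h5 : A j ⬝ᵥ z ≤ max ((A.mulVec a) j) 0 + 2 * ε := h1 j
      linarith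
    rw [norm_smul, norm_inv, Real.norm_eq_abs, abs_of_pos hε, inv_mul_lt_iff₀ hε] at h2
    exact h2.le
  -- A direction negative on every row would make the polyhedron unbounded. A nonnegative row bounds
  -- `δ` from below by −‖x‖, which gives compactness.
  have hsome : ∀ z : Fin k → ℝ, ∃ j, 0 ≤ (A.mulVec z) j := by
    intro z
    by_contra hcon
    push Not at hcon
    have hz0 : z = 0 := by
      by_contra hz
      have hzpos : 0 < ‖z‖ := norm_pos_iff.2 hz
      have h := hpoly ((feasibleRadius / ‖z‖) • z) fun j => by
        have h1 : A j ⬝ᵥ z < 0 := hcon j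
        rw [dotProduct_smul, smul_eq_mul]
        have h2 : feasibleRadius / ‖z‖ * (A j ⬝ᵥ z) ≤ 0 :=
          mul_nonpos_of_nonneg_of_nonpos (by positivity) h1.le
        have h3 : 0 ≤ 2 + 1000 * max (A j ⬝ᵥ u) 0 := by positivity
        exact h2.trans h3
      rw [norm_smul, Real.norm_eq_abs, abs_of_nonneg (by positivity),
        div_mul_cancel₀ _ hzpos.ne'] at h
      exact lt_irrefl _ h
    have := hcon ⟨0, hN⟩
    simp [hz0] at this
  refine ⟨exists_isLPSolution (B := ε * feasibleRadius + ‖x‖)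
    ⟨a, ε, lpFeasible_of_norm_sub_le hx⟩ ?_, fun z hz => ?_⟩
  · intro z δ hz
    refine ⟨(hbound z δ hz).trans (by linarith [norm_nonneg x]), ?_⟩
    obtain ⟨j, hj⟩ := hsome z
    have h2 : (A.mulVec z) j ≤ x j + δ := by
      rcases lt_or_ge ε (x j) with h | h
      · exact (hz.1 j h).2
      · exact hz.2.1 j h
    have h3 : x j ≤ ‖x‖ := (le_abs_self _).trans (norm_le_pi_norm x j)
    have h4 : 0 ≤ ε * feasibleRadius := by positivity
    linarith
  · obtain ⟨δ, hδ, _⟩ := hz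
    have h1 := hbound z δ hδ
    have h2 := norm_le_euclidean_norm a
    calc ‖z - a‖ ≤ ‖z‖ + ‖a‖ := norm_sub_le _ _
      _ ≤ _ := by linarith

/-! ### Propagation of signal and error through the layers -/

theorem sqrt_mul_norm_le_norm_reluLayer {N k m : ℕ} {A : Matrix (Fin N) (Fin k) ℝ}
    {y : Fin k → ℝ} {t : ℝ} (ht : 0 ≤ t)
    (hm : m ≤ (Finset.univ.filter fun j => t < A j ⬝ᵥ y).card) :
    √m * t ≤ ‖WithLp.toLp 2 (reluLayer A y)‖ := by
  rw [EuclideanSpace.norm_eq]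
  apply Real.le_sqrt_of_sq_le
  rw [mul_pow, Real.sq_sqrt (by positivity)]
  calc (m : ℝ) * t ^ 2 ≤ (Finset.univ.filter fun j => t < A j ⬝ᵥ y).card * t ^ 2 := by
        gcongr
    _ = ∑ j ∈ Finset.univ.filter fun j => t < A j ⬝ᵥ y, t ^ 2 := by simp
    _ ≤ ∑ j ∈ Finset.univ.filter fun j => t < A j ⬝ᵥ y, ‖reluLayer A y j‖ ^ 2 := by
        refine Finset.sum_le_sum fun j hj => ?_
        have hj' : t < A j ⬝ᵥ y := by simpa using hj
        have h1 : t ≤ reluLayer A y j := hj'.le.trans (le_max_left _ _)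
        rw [Real.norm_eq_abs, sq_abs]
        exact pow_le_pow_left₀ ht h1 2
    _ ≤ ∑ j, ‖reluLayer A y j‖ ^ 2 :=
        Finset.sum_le_sum_of_subset_of_nonneg (Finset.filter_subset _ _) fun _ _ _ => by positivity

section Recovery

variable {n m : ℕ → ℕ} {W : (i : ℕ) → Matrix (Fin (n (i + 1))) (Fin (n i)) ℝ} {d : ℕ}
  {zstar : Fin (n 0) → ℝ}

/-- Each layer multiplies the norm by at least √(m i)/500. The factor √(m 0) ≥ √(n 0) is kept from
the first layer only; later ones need just √(m i) ≥ 1. Nonvanishing of the outputs comes along by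
induction. -/
theorem pow_mul_le_norm_netOutput (hn0 : 0 < n 0) (hz : zstar ≠ 0) (hm0 : 0 < d → n 0 ≤ m 0)
    (hm : ∀ i < d, 0 < m i)
    (hcount : ∀ i < d, netOutput n W zstar i ≠ 0 →
      m i ≤ (Finset.univ.filter fun j => 1 / 500 * ‖WithLp.toLp 2 (netOutput n W zstar i)‖ <
        W i j ⬝ᵥ netOutput n W zstar i).card) :
    ∀ i < d, netOutput n W zstar i ≠ 0 ∧ (1 / 500) ^ (i + 1) * √(n 0) * ‖WithLp.toLp 2 zstar‖ ≤
      ‖WithLp.toLp 2 (netOutput n W zstar (i + 1))‖ := by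
  intro i
  induction i with
  | zero =>
    intro h
    refine ⟨hz, ?_⟩
    have h1 := sqrt_mul_norm_le_norm_reluLayer (by positivity) (hcount 0 h hz)
    refine le_trans ?_ h1
    have h2 : √(n 0 : ℝ) ≤ √(m 0 : ℝ) := Real.sqrt_le_sqrt (by exact_mod_cast hm0 h)
    rw [zero_add, pow_one]
    have h3 : 0 ≤ 1 / 500 * ‖WithLp.toLp 2 zstar‖ := by positivity
    have := mul_le_mul_of_nonneg_right h2 h3
    calc _ = √(n 0 : ℝ) * (1 / 500 * ‖WithLp.toLp 2 zstar‖) := by ring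
      _ ≤ _ := this
  | succ i ih =>
    intro h
    have ih' := (ih (by omega)).2
    have hzpos : 0 < ‖WithLp.toLp 2 zstar‖ := by
      rw [norm_pos_iff]
      simpa using hz
    have hne : netOutput n W zstar (i + 1) ≠ 0 := by
      intro h0
      rw [h0] at ih'
      simp only [WithLp.toLp_zero, norm_zero] at ih'
      have : (0 : ℝ) < n 0 := by exact_mod_cast hn0
      have : 0 < (1 / 500 : ℝ) ^ (i + 1) * √(n 0) * ‖WithLp.toLp 2 zstar‖ := by positivity
      linarith
    refine ⟨hne, ?_⟩
    have h1 := sqrt_mul_norm_le_norm_reluLayer (by positivity) (hcount (i + 1) h hne)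
    refine le_trans ?_ h1
    have h2 : 1 ≤ √(m (i + 1) : ℝ) := by
      rw [Real.one_le_sqrt]
      exact_mod_cast hm (i + 1) h
    calc _ = 1 / 500 * ((1 / 500) ^ (i + 1) * √(n 0) * ‖WithLp.toLp 2 zstar‖) := by
          rw [pow_succ (1 / 500 : ℝ) (i + 1)]; ring
      _ ≤ 1 / 500 * ‖WithLp.toLp 2 (netOutput n W zstar (i + 1))‖ := by gcongr
      _ ≤ _ := le_mul_of_one_le_left (by positivity) h2

/-- The layerwise inversion succeeds for weights that extend the sup norm, keep sufficiently many
coordinates of each layer large, and whose first layer has a bounded relaxed feasible region. -/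
theorem inversionRecovers_of_good {c : ℝ} (hc : 0 < c) (hc2 : c * (feasibleRadius + 1000) ≤ 2)
    (hn0 : 0 < n 0) (hn1 : ∀ i < d, 0 < n (i + 1)) (hz : zstar ≠ 0) (hm0 : 0 < d → n 0 ≤ m 0)
    (hm : ∀ i < d, 0 < m i)
    (hext : ∀ i < d, ∀ I : Finset (Fin (n (i + 1))), m i ≤ I.card → RowsExtend (W i) I c)
    (hcount : ∀ i < d, netOutput n W zstar i ≠ 0 →
      m i ≤ (Finset.univ.filter fun j => 1 / 500 * ‖WithLp.toLp 2 (netOutput n W zstar i)‖ <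
        W i j ⬝ᵥ netOutput n W zstar i).card)
    (hpoly : 0 < d → ∀ v : Fin (n 0) → ℝ, (∀ j, W 0 j ⬝ᵥ v ≤
      2 + 1000 * max (W 0 j ⬝ᵥ (‖WithLp.toLp 2 zstar‖⁻¹ • zstar)) 0) → ‖v‖ < feasibleRadius)
    {e : Fin (n d) → ℝ}
    (he : ‖e‖ < c ^ d / 2 ^ (d + 4) * ‖WithLp.toLp 2 zstar‖ * √(n 0)) :
    InversionRecovers n W d (netOutput n W zstar d + e) (fun i => ‖e‖ * (2 / c) ^ (d - i)) zstar
      (2 ^ d * ‖e‖ / c ^ d) := by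
  set tol : ℕ → ℝ := fun i => ‖e‖ * (2 / c) ^ (d - i) with htol
  set y := netOutput n W zstar with hy
  have hzpos : 0 < ‖WithLp.toLp 2 zstar‖ := by
    rw [norm_pos_iff]
    simpa using hz
  have hgrow := pow_mul_le_norm_netOutput hn0 hz hm0 hm hcount
  have htolsucc : ∀ i < d, tol i = tol (i + 1) * (2 / c) := by
    intro i hi
    simp only [htol]
    rw [show d - i = (d - (i + 1)) + 1 by omega, pow_succ]
    ring
  -- Beyond the input, both the tolerance bound and the signal bound contain √(n 0), and c/2 ≤ 1/500
  -- lets the decay of the tolerance beat that of the signal.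
  have htol2 : ∀ i < d, 1 ≤ i → 2 * tol (i + 1) ≤ 1 / 500 * ‖WithLp.toLp 2 (y i)‖ := by
    intro i hi hi1
    obtain ⟨l, rfl⟩ : ∃ l, i = l + 1 := ⟨i - 1, by omega⟩
    have h1 := (hgrow l (by omega)).2
    have hc' : c / 2 ≤ 1 / 500 := by
      have : c * (feasibleRadius + 1000) = c * 2001000 := by norm_num [feasibleRadius]
      rw [this] at hc2
      linarith
    have h2 : c ^ d / 2 ^ (d + 4) * (2 / c) ^ (d - (l + 1 + 1)) = 1 / 16 * (c / 2) ^ (l + 2) := by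
      obtain ⟨q, rfl⟩ : ∃ q, d = (l + 2) + q := ⟨d - (l + 2), by omega⟩
      rw [show l + 2 + q - (l + 1 + 1) = q by omega, pow_add c, pow_add, pow_add, div_pow, div_pow]
      field_simp
      ring
    calc 2 * tol (l + 1 + 1)
        = 2 * (‖e‖ * (2 / c) ^ (d - (l + 1 + 1))) := rfl
      _ ≤ 2 * (c ^ d / 2 ^ (d + 4) * ‖WithLp.toLp 2 zstar‖ * √(n 0) *
          (2 / c) ^ (d - (l + 1 + 1))) := by gcongr
      _ = 2 * (c ^ d / 2 ^ (d + 4) * (2 / c) ^ (d - (l + 1 + 1))) *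
          (√(n 0) * ‖WithLp.toLp 2 zstar‖) := by ring
      _ = 1 / 8 * (c / 2) ^ (l + 2) * (√(n 0) * ‖WithLp.toLp 2 zstar‖) := by rw [h2]; ring
      _ ≤ 1 * (1 / 500) ^ (l + 2) * (√(n 0) * ‖WithLp.toLp 2 zstar‖) := by
          gcongr
          norm_num
      _ = 1 / 500 * ((1 / 500) ^ (l + 1) * √(n 0) * ‖WithLp.toLp 2 zstar‖) := by
          rw [pow_succ (1 / 500 : ℝ) (l + 1)]; ring
      _ ≤ _ := by gcongr
  have hstandard : ∀ i < d, 2 * tol (i + 1) ≤ 1 / 500 * ‖WithLp.toLp 2 (y i)‖ →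
      ∀ x, ‖x - y (i + 1)‖ ≤ tol (i + 1) →
      (∃ z, IsLPSolution (W i) x (tol (i + 1)) z) ∧
        ∀ z, IsLPSolution (W i) x (tol (i + 1)) z → ‖z - y i‖ ≤ tol (i + 1) * (2 / c) := by
    intro i hi hle x hx
    have hcard := hcount i hi (hgrow i hi).1
    refine lp_recovers_of_rowsExtend hc hx ?_ (fun j hj => ?_) (hext i hi _ hcard)
    · rw [← Finset.card_pos]
      exact (hm i hi).trans_le hcard
    · have hj' := (Finset.mem_filter.1 hj).2
      exact hle.trans_lt hj'
  have hstep : ∀ i < d, ∀ x, ‖x - y (i + 1)‖ ≤ tol (i + 1) →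
      (∃ z, IsLPSolution (W i) x (tol (i + 1)) z) ∧
        ∀ z, IsLPSolution (W i) x (tol (i + 1)) z → ‖z - y i‖ ≤ tol i := by
    intro i hi x hx
    rw [htolsucc i hi]
    -- A large tolerance is possible only at the input, where the bounded-polyhedron estimate takes
    -- over.
    rcases le_or_gt (2 * tol (i + 1)) (1 / 500 * ‖WithLp.toLp 2 (y i)‖) with hle | hgt
    · exact hstandard i hi hle x hx
    · obtain rfl : i = 0 := by
        by_contra h0
        exact absurd (htol2 i hi (by omega)) (not_le.2 hgt)
      have hy0 : y 0 = zstar := rfl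
      rw [hy0] at hgt ⊢
      have hpos : 0 < tol (0 + 1) := by
        have : 0 < 1 / 500 * ‖WithLp.toLp 2 zstar‖ := by positivity
        linarith
      have h := lp_recovers_of_bounded (A := W 0) (a := zstar) (hn1 0 hi) hx
        (by rw [smul_smul, mul_inv_cancel₀ hzpos.ne', one_smul]) (by linarith) hpos (hpoly hi)
      refine ⟨h.1, fun z hz => (h.2 z hz).trans ?_⟩
      refine mul_le_mul_of_nonneg_left ?_ hpos.le
      rw [le_div_iff₀ hc]
      linarith
  have hreach : ∀ i x, InversionReaches n W d (y d + e) tol i x → i ≤ d ∧ ‖x - y i‖ ≤ tol i := by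
    intro i x h
    induction h with
    | start => exact ⟨le_rfl, by simp [htol]⟩
    | step _ hsol ih => exact ⟨by omega, (hstep _ (by omega) _ ih.2).2 _ hsol⟩
  refine ⟨fun i hi x hx => (hstep i hi x (hreach _ _ hx).2).1, fun z hz => ?_⟩
  refine (hreach 0 z hz).2.trans_eq ?_
  simp only [htol, Nat.sub_zero, div_pow]
  ring

end Recovery

/-! ### Laws of the weights and of the layer outputs -/

section Law

variable {Ω : Type*} [MeasurableSpace Ω] {μ : Measure Ω} [IsProbabilityMeasure μ] {d : ℕ}
  {n : ℕ → ℕ} {W : (i : ℕ) → Ω → Matrix (Fin (n (i + 1))) (Fin (n i)) ℝ}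

/-- Distinct rows of a weight matrix are independent Gaussian vectors. -/
theorem IsIIDStdGaussian.hasLaw_rows (hW : IsIIDStdGaussian μ d n W) {i : ℕ} (hi : i < d)
    {J : Type*} [Fintype J] {f : J → Fin (n (i + 1))} (hf : Function.Injective f) :
    HasLaw (fun ω (j : J) => W i ω (f j)) (Measure.pi fun _ => gaussianRow (n i)) μ := by
  have hae : ∀ q : J × Fin (n i), AEMeasurable (fun ω => W i ω (f q.1) q.2) μ :=
    fun q => (hW.1 i hi (f q.1) q.2).aemeasurable
  let g : J × Fin (n i) → Σ i : Fin d, Fin (n (i + 1)) × Fin (n i) :=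
    fun q => ⟨⟨i, hi⟩, f q.1, q.2⟩
  have hg : Function.Injective g := by
    rintro ⟨a, b⟩ ⟨a', b'⟩ h
    simp only [g, Sigma.mk.injEq, heq_eq_eq, Prod.mk.injEq, true_and] at h
    exact Prod.ext (hf h.1) h.2
  have hind : iIndepFun (fun (q : J × Fin (n i)) ω => W i ω (f q.1) q.2) μ := hW.2.precomp hg
  have hmap := (iIndepFun_iff_map_fun_eq_pi_map hae).1 hind
  have hgauss : ∀ q : J × Fin (n i), μ.map (fun ω => W i ω (f q.1) q.2) = gaussianReal 0 1 :=
    fun q => (hW.1 i hi (f q.1) q.2).map_eq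
  simp_rw [hgauss] at hmap
  refine ⟨aemeasurable_pi_lambda _ fun j => aemeasurable_pi_lambda _ fun b => hae (j, b), ?_⟩
  have hcurry := Measure.infinitePi_map_curry
    (fun (_ : J) (_ : Fin (n i)) => gaussianReal 0 1)
  simp_rw [Measure.infinitePi_eq_pi] at hcurry
  rw [← hcurry, ← hmap, AEMeasurable.map_map_of_aemeasurable
    (MeasurableEquiv.measurable _).aemeasurable (aemeasurable_pi_lambda _ hae)]
  rfl

/-- Stated as an inequality so that `B` need not be measurable: the bad events quantify over
uncountably many points. -/
theorem IsIIDStdGaussian.measure_le (hW : IsIIDStdGaussian μ d n W) {i : ℕ} (hi : i < d)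
    {J : Type*} [Fintype J] {f : J → Fin (n (i + 1))} (hf : Function.Injective f)
    (B : Set (J → Fin (n i) → ℝ)) :
    μ {ω | (fun j : J => W i ω (f j)) ∈ B} ≤ (Measure.pi fun _ : J => gaussianRow (n i)) B := by
  have h := hW.hasLaw_rows hi hf
  rw [← h.map_eq]
  exact Measure.le_map_apply h.aemeasurable B

theorem netOutput_congr {n : ℕ → ℕ} {W W' : (i : ℕ) → Matrix (Fin (n (i + 1))) (Fin (n i)) ℝ}
    (z : Fin (n 0) → ℝ) {i : ℕ} (h : ∀ j < i, W j = W' j) :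
    netOutput n W z i = netOutput n W' z i := by
  induction i with
  | zero => rfl
  | succ i ih =>
    simp only [netOutput]
    rw [ih fun j hj => h j (by omega), h i (by omega)]

theorem measurable_netOutput {α : Type*} [MeasurableSpace α] {n : ℕ → ℕ}
    {W : α → (i : ℕ) → Matrix (Fin (n (i + 1))) (Fin (n i)) ℝ} (z : Fin (n 0) → ℝ)
    (hW : ∀ i a b, Measurable fun x => W x i a b) (i : ℕ) :
    Measurable fun x => netOutput n (W x) z i := by
  induction i with
  | zero => exact measurable_const
  | succ i ih =>
    rw [measurable_pi_iff]
    intro a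
    simp only [netOutput, reluLayer, Matrix.mulVec, dotProduct]
    refine Measurable.max (Finset.measurable_fun_sum _ fun b _ => (hW i a b).mul ?_)
      measurable_const
    exact (measurable_pi_apply b).comp ih

/-- The output of layer `i` is independent of the weights of the next layer. -/
theorem IsIIDStdGaussian.hasLaw_netOutput_prod (hW : IsIIDStdGaussian μ d n W) {i : ℕ}
    (hi : i < d) (z : Fin (n 0) → ℝ) :
    HasLaw (fun ω => (netOutput n (fun i => W i ω) z i, fun j => W i ω j))
      ((μ.map fun ω => netOutput n (fun i => W i ω) z i).prod
        (Measure.pi fun _ => gaussianRow (n i))) μ := by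
  classical
  let ι := Σ i : Fin d, Fin (n (i + 1)) × Fin (n i)
  let X : ι → Ω → ℝ := fun p ω => W p.1 ω p.2.1 p.2.2
  have hX : ∀ p, AEMeasurable (X p) μ := fun p => (hW.1 p.1 p.1.2 p.2.1 p.2.2).aemeasurable
  let S : Finset ι := Finset.univ.filter fun p => (p.1 : ℕ) < i
  let T : Finset ι := Finset.univ.filter fun p => (p.1 : ℕ) = i
  have hST : Disjoint S T := by
    rw [Finset.disjoint_left]
    intro p hp hp'
    simp only [S, T, Finset.mem_filter] at hp hp'
    omega
  have hindep := iIndepFun.indepFun_finset₀ S T hST hW.2 hX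
  -- The output of layer `i` sees only earlier weights, so later ones may be filled with zeros.
  let V : (S → ℝ) → (j : ℕ) → Matrix (Fin (n (j + 1))) (Fin (n j)) ℝ := fun x j a b =>
    if h : j < i then x ⟨⟨⟨j, h.trans hi⟩, a, b⟩, by simp [S, h]⟩ else 0
  have hV : ∀ j a b, Measurable fun x => V x j a b := by
    intro j a b
    by_cases h : j < i
    · simp only [V, h, dite_true]
      fun_prop
    · simp only [V, h, dite_false]
      exact measurable_const
  let G : (T → ℝ) → Fin (n (i + 1)) → Fin (n i) → ℝ := fun x a b =>
    x ⟨⟨⟨i, hi⟩, a, b⟩, by simp [T]⟩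
  have hG : Measurable G := by
    refine measurable_pi_lambda _ fun a => measurable_pi_lambda _ fun b => ?_
    exact measurable_pi_apply _
  have hcomp := hindep.comp (measurable_netOutput z hV i) hG
  have hfst : (fun x => netOutput n (V x) z i) ∘ (fun ω (p : S) => X p ω) =
      fun ω => netOutput n (fun i => W i ω) z i := by
    ext1 ω
    refine netOutput_congr z fun j hj => ?_
    ext a b
    simp [V, X, hj]
  have hsnd : G ∘ (fun ω (p : T) => X p ω) = fun ω j => W i ω j := rfl
  have hcomp' : IndepFun (fun ω => netOutput n (fun i => W i ω) z i)
      (fun ω j => W i ω j) μ := by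
    rw [← hfst, ← hsnd]
    exact hcomp
  have h1 : AEMeasurable (fun ω => netOutput n (fun i => W i ω) z i) μ := by
    rw [← hfst]
    exact (measurable_netOutput z hV i).comp_aemeasurable
      (aemeasurable_pi_lambda _ fun p => hX p)
  have h2 := hW.hasLaw_rows hi Function.injective_id
  refine ⟨h1.prodMk h2.aemeasurable, ?_⟩
  have := (indepFun_iff_map_prod_eq_prod_map_map h1 h2.aemeasurable).1 hcomp'
  rw [h2.map_eq] at this
  exact this

/-- Fubini: condition on the layer output and apply the fixed-vector bound to the fresh weights. -/
theorem measure_card_large_lt_le (hW : IsIIDStdGaussian μ d n W) {i : ℕ}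
    (hi : i < d) (z : Fin (n 0) → ℝ) {m : ℕ} (hm : 5 * m ≤ 2 * n (i + 1)) :
    μ {ω | netOutput n (fun i => W i ω) z i ≠ 0 ∧ (Finset.univ.filter fun j =>
        1 / 500 * ‖WithLp.toLp 2 (netOutput n (fun i => W i ω) z i)‖ <
          W i ω j ⬝ᵥ netOutput n (fun i => W i ω) z i).card < m} ≤
      ENNReal.ofReal ((99 / 100) ^ n (i + 1)) := by
  let B : Set ((Fin (n i) → ℝ) × (Fin (n (i + 1)) → Fin (n i) → ℝ)) :=
    {q | q.1 ≠ 0 ∧ (Finset.univ.filter fun j =>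
      1 / 500 * ‖WithLp.toLp 2 q.1‖ < q.2 j ⬝ᵥ q.1).card < m}
  have hB : MeasurableSet B := by
    have h1 : MeasurableSet {q : (Fin (n i) → ℝ) × (Fin (n (i + 1)) → Fin (n i) → ℝ) | q.1 ≠ 0} :=
      (measurableSet_eq_fun measurable_fst measurable_const).compl
    refine h1.inter ?_
    have h2 : Measurable fun q : (Fin (n i) → ℝ) × (Fin (n (i + 1)) → Fin (n i) → ℝ) =>
        ∑ j, if 1 / 500 * ‖WithLp.toLp 2 q.1‖ < q.2 j ⬝ᵥ q.1 then 1 else 0 := by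
      refine Finset.measurable_fun_sum _ fun j _ =>
        Measurable.ite (measurableSet_lt ?_ ?_) measurable_const measurable_const
      · have : Measurable fun v : Fin (n i) → ℝ => WithLp.toLp 2 v := by fun_prop
        fun_prop
      · simp only [dotProduct]
        fun_prop
    simp only [Finset.card_filter]
    exact measurableSet_lt h2 measurable_const
  have hlaw := hW.hasLaw_netOutput_prod hi z
  have hy : AEMeasurable (fun ω => netOutput n (fun i => W i ω) z i) μ :=
    measurable_fst.comp_aemeasurable hlaw.aemeasurable
  have : IsProbabilityMeasure (μ.map fun ω => netOutput n (fun i => W i ω) z i) :=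
    Measure.isProbabilityMeasure_map hy
  have h := Measure.le_map_apply hlaw.aemeasurable B
  rw [hlaw.map_eq, Measure.prod_apply hB] at h
  refine h.trans ((lintegral_mono fun y => ?_).trans_eq
    (by simp : ∫⁻ _, ENNReal.ofReal ((99 / 100) ^ n (i + 1))
      ∂(μ.map fun ω => netOutput n (fun i => W i ω) z i) = _))
  by_cases hy0 : y = 0
  · have : Prod.mk y ⁻¹' B = ∅ := by
      ext A
      simp [B, hy0]
    rw [this]
    simp
  · have := measure_pi_card_large_lt_le (J := Fin (n (i + 1))) (m := m) (by simpa using hm) hy0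
    rw [Fintype.card_fin] at this
    refine (measure_mono ?_).trans this
    intro A hA
    exact hA.2

theorem measure_not_rowsExtend_le (hW : IsIIDStdGaussian μ d n W) {i : ℕ} (hi : i < d)
    {I : Finset (Fin (n (i + 1)))} (hI : n i ≤ I.card) {c : ℝ} (hc0 : 0 ≤ c) (hc1 : c ≤ 1) :
    μ {ω | ¬ RowsExtend (W i ω) I c} ≤
      ENNReal.ofReal (n i * (4 ^ I.card * c ^ (I.card - n i))) := by
  classical
  have h := measure_pi_exists_small_le (J := I) (k := n i) hc0 hc1 (by simpa using hI)
  rw [Fintype.card_coe] at h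
  refine le_trans (measure_mono ?_)
    ((hW.measure_le hi (Subtype.val_injective (p := (· ∈ I))) _).trans h)
  intro ω hω
  have hω' : ¬ ∀ x : Fin (n i) → ℝ, c * ‖x‖ ≤
      ‖((W i ω).submatrix (fun j : I => (j : Fin (n (i + 1)))) id).mulVec x‖ := hω
  push Not at hω'
  obtain ⟨x, hx⟩ := hω'
  refine ⟨x, ?_, fun j => ?_⟩
  · rintro rfl
    simp at hx
  · exact (norm_le_pi_norm (((W i ω).submatrix (fun j : I => (j : Fin (n (i + 1)))) id).mulVec x)
      j).trans hx.le

end Law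

theorem RowsExtend.mono {N k : ℕ} {A : Matrix (Fin N) (Fin k) ℝ} {I I' : Finset (Fin N)} {c : ℝ}
    (h : RowsExtend A I c) (hI : I ⊆ I') : RowsExtend A I' c := by
  intro x
  refine (h x).trans ((pi_norm_le_iff_of_nonneg (norm_nonneg _)).2 fun j => ?_)
  exact norm_le_pi_norm ((A.submatrix (fun j : I' => (j : Fin N)) id).mulVec x) ⟨j, hI j.2⟩

/-! ### Exponential bounds for the bad events -/

/-- The constant with which the weight matrices extend the sup norm. -/
noncomputable abbrev extensionConstant : ℝ := (1 / 100) ^ 12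

section Bounds

variable {Ω : Type*} [MeasurableSpace Ω] {μ : Measure Ω} [IsProbabilityMeasure μ] {d : ℕ}
  {n : ℕ → ℕ} {W : (i : ℕ) → Ω → Matrix (Fin (n (i + 1))) (Fin (n i)) ℝ}

theorem natCast_le_two_pow (k : ℕ) : (k : ℝ) ≤ 2 ^ k := by
  exact_mod_cast k.lt_two_pow_self.le

/-- Extension passes to larger row sets, so exactly 2 n_i rows may be assumed. The bound is then (32
c)^(n_i), after n_i ≤ 2^(n_i). -/
theorem eachSubmatrixExtends_gaussian (hW : IsIIDStdGaussian μ d n W) {i : ℕ} (hi : i < d) :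
    EachSubmatrixExtends μ (W i) (2 * n i) extensionConstant ((99 / 100) ^ n i) := by
  intro I hI
  obtain ⟨I', hI'I, hI'⟩ := Finset.exists_subset_card_eq hI
  have hsub : {ω | ¬ RowsExtend (W i ω) I extensionConstant} ⊆
      {ω | ¬ RowsExtend (W i ω) I' extensionConstant} := fun ω hω h => hω (h.mono hI'I)
  refine (measure_mono hsub).trans ((measure_not_rowsExtend_le hW hi (by omega)
    (by norm_num) (by norm_num)).trans (ENNReal.ofReal_le_ofReal ?_))
  rw [hI', show 2 * n i - n i = n i by omega, pow_mul]
  calc (n i : ℝ) * ((4 ^ 2) ^ n i * extensionConstant ^ n i)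
      ≤ 2 ^ n i * ((4 ^ 2) ^ n i * extensionConstant ^ n i) := by
        gcongr
        exact natCast_le_two_pow _
    _ = (2 * (4 ^ 2 * extensionConstant)) ^ n i := by rw [mul_pow, mul_pow]
    _ ≤ _ := pow_le_pow_left₀ (by positivity) (by norm_num) _

theorem allSubmatricesExtend_gaussian (hW : IsIIDStdGaussian μ d n W) {i : ℕ} (hi : i < d)
    (hpos : 0 < n i) (hn : 5 * n i ≤ n (i + 1)) :
    AllSubmatricesExtend μ (W i) (2 * n (i + 1) / 5) extensionConstant
      ((99 / 100) ^ n (i + 1)) := by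
  set N := n (i + 1) with hN
  set m := 2 * N / 5 with hm
  have hsub : {ω | ¬ ∀ I : Finset (Fin N), m ≤ I.card → RowsExtend (W i ω) I extensionConstant} ⊆
      ⋃ I ∈ Finset.powersetCard m (Finset.univ : Finset (Fin N)),
        {ω | ¬ RowsExtend (W i ω) I extensionConstant} := by
    intro ω hω
    have hω' : ¬ ∀ I : Finset (Fin N), m ≤ I.card →
      RowsExtend (W i ω) I extensionConstant := hω
    push Not at hω'
    obtain ⟨I, hI, hnot⟩ := hω'
    obtain ⟨I', hI'I, hI'⟩ := Finset.exists_subset_card_eq hI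
    simp only [Set.mem_iUnion]
    exact ⟨I', Finset.mem_powersetCard.2 ⟨Finset.subset_univ _, hI'⟩,
      fun h => hnot (h.mono hI'I)⟩
  have hterm : ∀ I ∈ Finset.powersetCard m (Finset.univ : Finset (Fin N)),
      μ {ω | ¬ RowsExtend (W i ω) I extensionConstant} ≤
        ENNReal.ofReal (n i * (4 ^ m * extensionConstant ^ (m - n i))) := by
    intro I hI
    have hcard := (Finset.mem_powersetCard.1 hI).2
    have h := measure_not_rowsExtend_le hW hi (I := I) (c := extensionConstant)
      (by rw [hcard]; omega) (by norm_num) (by norm_num)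
    rwa [hcard] at h
  refine (measure_mono hsub).trans ((measure_biUnion_finset_le _ _).trans
    ((Finset.sum_le_card_nsmul _ _ _ hterm).trans ?_))
  rw [nsmul_eq_mul, ← ENNReal.ofReal_natCast, ← ENNReal.ofReal_mul (by positivity)]
  refine ENNReal.ofReal_le_ofReal ?_
  have hcount : ((Finset.powersetCard m (Finset.univ : Finset (Fin N))).card : ℝ) ≤ 2 ^ N := by
    rw [Finset.card_powersetCard, Finset.card_univ, Fintype.card_fin]
    exact_mod_cast Nat.choose_le_two_pow N m
  have hk : (n i : ℝ) ≤ 2 ^ N :=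
    (natCast_le_two_pow _).trans (pow_le_pow_right₀ (by norm_num) (by omega))
  have h4 : (4 : ℝ) ^ m ≤ 4 ^ N := pow_le_pow_right₀ (by norm_num) (by omega)
  -- The exponent 12 in the constant ensures 12 (m − n_i) ≥ N despite the rounding in m. The
  -- remaining factors 2^N · 2^N · 4^N are then beaten by 100^(−N).
  have hc : extensionConstant ^ (m - n i) ≤ (1 / 100) ^ N := by
    rw [← pow_mul]
    exact pow_le_pow_of_le_one (by norm_num) (by norm_num) (by omega)
  calc _ ≤ (2 : ℝ) ^ N * (2 ^ N * (4 ^ N * (1 / 100) ^ N)) := by gcongr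
    _ = (2 * (2 * (4 * (1 / 100)))) ^ N := by simp only [mul_pow]
    _ ≤ _ := pow_le_pow_left₀ (by positivity) (by norm_num) _

theorem measure_exists_relaxed_feasible_le (hW : IsIIDStdGaussian μ d n W) (hd : 0 < d)
    (hn : 5 * n 0 ≤ n 1) {u : Fin (n 0) → ℝ} (hu : ‖WithLp.toLp 2 u‖ = 1) :
    μ {ω | ∃ v : Fin (n 0) → ℝ, feasibleRadius ≤ ‖v‖ ∧
        ∀ j, W 0 ω j ⬝ᵥ v ≤ 2 + 1000 * max (W 0 ω j ⬝ᵥ u) 0} ≤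
      ENNReal.ofReal (40 * (99 / 100) ^ n 0) := by
  have h := measure_pi_exists_large_le (J := Fin (n 1)) hu
  rw [Fintype.card_fin] at h
  refine ((hW.measure_le hd Function.injective_id _).trans h).trans (ENNReal.ofReal_le_ofReal ?_)
  -- The prefactor must be absorbed at a rate close to 1, since 8 (129/200)^5 ≈ 0.89 leaves little
  -- room below 99/100.
  have hk : (n 0 : ℝ) ≤ 20 * (21 / 20) ^ n 0 := by
    have := one_add_mul_le_pow (a := (1 / 20 : ℝ)) (by norm_num) (n 0)
    norm_num at this
    linarith
  have hpow : (129 / 200 : ℝ) ^ n 1 ≤ ((129 / 200) ^ 5) ^ n 0 := by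
    rw [← pow_mul]
    exact pow_le_pow_of_le_one (by norm_num) (by norm_num) hn
  calc (2 : ℝ) * n 0 * (8 ^ n 0 * (129 / 200) ^ n 1)
      ≤ 2 * (20 * (21 / 20) ^ n 0) * (8 ^ n 0 * ((129 / 200) ^ 5) ^ n 0) := by gcongr
    _ = 40 * ((21 / 20) * (8 * (129 / 200) ^ 5)) ^ n 0 := by simp only [mul_pow]; ring
    _ ≤ _ := by
      refine mul_le_mul_of_nonneg_left (pow_le_pow_left₀ (by positivity) ?_ _) (by norm_num)
      norm_num

end Bounds

/-! ### Summation over the layers and conclusion -/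

theorem pow_le_exp_neg (k : ℕ) : (99 / 100 : ℝ) ^ k ≤ Real.exp (-(1 / 100) * k) := by
  rw [mul_comm, Real.exp_nat_mul]
  refine pow_le_pow_left₀ (by norm_num) ?_ k
  have := Real.add_one_le_exp (-(1 / 100) : ℝ)
  linarith

theorem add_le_layer_width {n : ℕ → ℕ} {d : ℕ} (hn0 : 0 < n 0)
    (hn : ∀ i < d, 5 * n i ≤ n (i + 1)) {i : ℕ} (hi : i ≤ d) : n 0 + i ≤ n i := by
  induction i with
  | zero => exact le_rfl
  | succ i ih =>
    have := ih (by omega)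
    have := hn i (by omega)
    omega

/-- Widths grow at least by one per layer, so a geometric series removes the dependence on d. -/
theorem sum_pow_layer_width_le {n : ℕ → ℕ} {d : ℕ} (hn0 : 0 < n 0)
    (hn : ∀ i < d, 5 * n i ≤ n (i + 1)) :
    ∑ i ∈ Finset.range d, (99 / 100 : ℝ) ^ n (i + 1) ≤ 100 * (99 / 100) ^ n 0 := by
  calc ∑ i ∈ Finset.range d, (99 / 100 : ℝ) ^ n (i + 1)
      ≤ ∑ i ∈ Finset.range d, (99 / 100 : ℝ) ^ n 0 * (99 / 100) ^ i := by
        refine Finset.sum_le_sum fun i hi => ?_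
        have hi' := Finset.mem_range.1 hi
        rw [← pow_add]
        exact pow_le_pow_of_le_one (by norm_num) (by norm_num)
          ((by omega : n 0 + i ≤ n 0 + (i + 1)).trans (add_le_layer_width hn0 hn hi'))
    _ = (99 / 100 : ℝ) ^ n 0 * ∑ i ∈ Finset.range d, (99 / 100 : ℝ) ^ i := by
        rw [Finset.mul_sum]
    _ ≤ (99 / 100 : ℝ) ^ n 0 * 100 := by
        refine mul_le_mul_of_nonneg_left ?_ (by positivity)
        rw [geom_sum_eq (by norm_num)]
        have : (0 : ℝ) ≤ (99 / 100) ^ d := by positivity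
        norm_num
        linarith
    _ = _ := mul_comm _ _

theorem measure_not_inversionRecovers_le {Ω : Type*} [MeasurableSpace Ω] {μ : Measure Ω}
    [IsProbabilityMeasure μ] {d : ℕ} {n : ℕ → ℕ}
    {W : (i : ℕ) → Ω → Matrix (Fin (n (i + 1))) (Fin (n i)) ℝ} (hW : IsIIDStdGaussian μ d n W)
    (hn0 : 0 < n 0) (hn : ∀ i < d, 5 * n i ≤ n (i + 1)) (zstar : Fin (n 0) → ℝ) :
    μ {ω | ¬ ∀ e : Fin (n d) → ℝ,
        ‖e‖ < extensionConstant ^ d / 2 ^ (d + 4) * ‖WithLp.toLp 2 zstar‖ * √(n 0) →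
        InversionRecovers n (fun i => W i ω) d
          (netOutput n (fun i => W i ω) zstar d + e)
          (fun i => ‖e‖ * (2 / extensionConstant) ^ (d - i)) zstar
          (2 ^ d * ‖e‖ / extensionConstant ^ d)} ≤
      ENNReal.ofReal (240 * (99 / 100) ^ n 0) := by
  -- For a zero signal the strict bound on the error is unsatisfiable.
  rcases eq_or_ne zstar 0 with rfl | hz
  · simp only [WithLp.toLp_zero, norm_zero, mul_zero, zero_mul, not_lt.2 (norm_nonneg _),
      false_imp_iff, implies_true, not_true_eq_false, Set.ofPred_false, measure_empty, zero_le]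
  set m : ℕ → ℕ := fun i => 2 * n (i + 1) / 5 with hm
  have hnpos : ∀ i ≤ d, 0 < n i := fun i hi => by
    have := add_le_layer_width hn0 hn hi
    omega
  set u := ‖WithLp.toLp 2 zstar‖⁻¹ • zstar with hu
  have hzpos : 0 < ‖WithLp.toLp 2 zstar‖ := by
    rw [norm_pos_iff]
    simpa using hz
  have hu1 : ‖WithLp.toLp 2 u‖ = 1 := by
    rw [hu, WithLp.toLp_smul, norm_smul, norm_inv, norm_norm, inv_mul_cancel₀ hzpos.ne']
  let ExtBad : ℕ → Set Ω := fun i => {ω | ¬ ∀ I : Finset (Fin (n (i + 1))), m i ≤ I.card →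
    RowsExtend (W i ω) I extensionConstant}
  let CountBad : ℕ → Set Ω := fun i => {ω | netOutput n (fun i => W i ω) zstar i ≠ 0 ∧
    (Finset.univ.filter fun j =>
      1 / 500 * ‖WithLp.toLp 2 (netOutput n (fun i => W i ω) zstar i)‖ <
        W i ω j ⬝ᵥ netOutput n (fun i => W i ω) zstar i).card < m i}
  let PolyBad : Set Ω := {ω | 0 < d ∧ ∃ v : Fin (n 0) → ℝ, feasibleRadius ≤ ‖v‖ ∧
    ∀ j, W 0 ω j ⬝ᵥ v ≤ 2 + 1000 * max (W 0 ω j ⬝ᵥ u) 0}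
  have hExt : ∀ i ∈ Finset.range d, μ (ExtBad i) ≤ ENNReal.ofReal ((99 / 100) ^ n (i + 1)) :=
    fun i hi => by
      have hi' := Finset.mem_range.1 hi
      exact allSubmatricesExtend_gaussian hW hi' (hnpos i hi'.le) (hn i hi')
  have hCount : ∀ i ∈ Finset.range d, μ (CountBad i) ≤ ENNReal.ofReal ((99 / 100) ^ n (i + 1)) :=
    fun i hi => measure_card_large_lt_le hW (Finset.mem_range.1 hi) zstar
      (by simp only [hm]; omega)
  have hPoly : μ PolyBad ≤ ENNReal.ofReal (40 * (99 / 100) ^ n 0) := by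
    by_cases hd : 0 < d
    · exact (measure_mono fun ω hω => hω.2).trans
        (measure_exists_relaxed_feasible_le hW hd (hn 0 hd) hu1)
    · have : PolyBad = ∅ := by
        ext ω
        simp [PolyBad, hd]
      simp [this]
  have hsub : {ω | ¬ ∀ e : Fin (n d) → ℝ,
        ‖e‖ < extensionConstant ^ d / 2 ^ (d + 4) * ‖WithLp.toLp 2 zstar‖ * √(n 0) →
        InversionRecovers n (fun i => W i ω) d
          (netOutput n (fun i => W i ω) zstar d + e)
          (fun i => ‖e‖ * (2 / extensionConstant) ^ (d - i)) zstar
          (2 ^ d * ‖e‖ / extensionConstant ^ d)} ⊆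
      (⋃ i ∈ Finset.range d, ExtBad i) ∪ (⋃ i ∈ Finset.range d, CountBad i) ∪ PolyBad := by
    intro ω hω
    by_contra hcon
    simp only [Set.mem_union, Set.mem_iUnion, not_or, not_exists, Finset.mem_range] at hcon
    obtain ⟨⟨h1, h2⟩, h3⟩ := hcon
    refine hω fun e he => inversionRecovers_of_good (m := m) (by norm_num) (by norm_num) hn0
      (fun i hi => hnpos (i + 1) hi) hz ?_ ?_ ?_ ?_ ?_ he
    · intro hd
      have := hn 0 hd
      simp only [hm]
      omega
    · intro i hi
      have := hn i hi
      have := hnpos i hi.le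
      simp only [hm]
      omega
    · exact fun i hi => not_not.1 (h1 i hi)
    · exact fun i hi hne => not_lt.1 fun hlt => h2 i hi ⟨hne, hlt⟩
    · exact fun hd v hv => not_le.1 fun hle => h3 ⟨hd, v, hle, hv⟩
  have hsum : ∀ Bad : ℕ → Set Ω,
      (∀ i ∈ Finset.range d, μ (Bad i) ≤ ENNReal.ofReal ((99 / 100) ^ n (i + 1))) →
      μ (⋃ i ∈ Finset.range d, Bad i) ≤ ENNReal.ofReal (100 * (99 / 100) ^ n 0) := by
    intro Bad hBad
    refine (measure_biUnion_finset_le _ _).trans ((Finset.sum_le_sum hBad).trans ?_)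
    rw [← ENNReal.ofReal_sum_of_nonneg fun _ _ => by positivity]
    exact ENNReal.ofReal_le_ofReal (sum_pow_layer_width_le hn0 hn)
  -- The constant is 240 = 100 + 100 + 40: extension, counting, polyhedron.
  refine (measure_mono hsub).trans ((measure_union_le _ _).trans
    ((add_le_add ((measure_union_le _ _).trans (add_le_add (hsum _ hExt) (hsum _ hCount)))
      hPoly).trans_eq ?_))
  rw [← ENNReal.ofReal_add (by positivity) (by positivity),
    ← ENNReal.ofReal_add (by positivity) (by positivity)]
  congr 1
  ring

theorem corollary1 :
    ∃ c₂ C γ : ℝ, 0 < c₂ ∧ c₂ ≤ 2 ∧ 0 < C ∧ 0 < γ ∧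
      ∀ (d : ℕ) (n : ℕ → ℕ), 0 < n 0 → (∀ i < d, 5 * n i ≤ n (i + 1)) →
      ∀ (Ω : Type*) [MeasurableSpace Ω] (μ : Measure Ω) [IsProbabilityMeasure μ]
        (W : (i : ℕ) → Ω → Matrix (Fin (n (i + 1))) (Fin (n i)) ℝ),
        IsIIDStdGaussian μ d n W →
        (∀ i < d,
          (∃ m : ℕ, n i < m ∧ 5 * m ≤ 2 * n (i + 1) ∧
            AllSubmatricesExtend μ (W i) m c₂ (C * Real.exp (-γ * n i))) ∧
          EachSubmatrixExtends μ (W i) (2 * n i) c₂ (C * Real.exp (-γ * n i))) ∧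
        ∀ zstar : Fin (n 0) → ℝ,
          μ {ω | ¬ ∀ e : Fin (n d) → ℝ,
              ‖e‖ < c₂ ^ d / 2 ^ (d + 4) * ‖WithLp.toLp 2 zstar‖ * √(n 0) →
              InversionRecovers n (fun i => W i ω) d
                (netOutput n (fun i => W i ω) zstar d + e)
                (fun i => ‖e‖ * (2 / c₂) ^ (d - i)) zstar
                (2 ^ d * ‖e‖ / c₂ ^ d)} ≤
            ENNReal.ofReal (C * Real.exp (-γ * n 0)) := by
  refine ⟨extensionConstant, 240, 1 / 100, by norm_num, by norm_num, by norm_num, by norm_num, ?_⟩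
  intro d n hn0 hn Ω _ μ _ W hW
  have hexp : ∀ k : ℕ, (99 / 100 : ℝ) ^ k ≤ 240 * Real.exp (-(1 / 100) * k) := fun k => by
    have := pow_le_exp_neg k
    have := Real.exp_nonneg (-(1 / 100) * (k : ℝ))
    linarith
  refine ⟨fun i hi => ⟨⟨2 * n (i + 1) / 5, ?_, by omega, ?_⟩, ?_⟩, fun zstar => ?_⟩
  · have := add_le_layer_width hn0 hn hi.le
    have := hn i hi
    omega
  · have hpos := add_le_layer_width hn0 hn hi.le
    have hni := hn i hi
    refine le_trans (allSubmatricesExtend_gaussian hW hi (by omega) hni)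
      (ENNReal.ofReal_le_ofReal (le_trans ?_ (hexp (n i))))
    exact pow_le_pow_of_le_one (by norm_num) (by norm_num) (by omega)
  · exact fun I hI => (eachSubmatrixExtends_gaussian hW hi I hI).trans
      (ENNReal.ofReal_le_ofReal (hexp (n i)))
  · refine (measure_not_inversionRecovers_le hW hn0 hn zstar).trans
      (ENNReal.ofReal_le_ofReal ?_)
    exact mul_le_mul_of_nonneg_left (pow_le_exp_neg _) (by norm_num)
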